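/- Work over $\mathbb C$. Let $\mathbb F=\mathbb F(0,1,1,2)=\big((\mathbb C^2\setminus 0)\times(\mathbb C^4\setminus 0)\big)/(\mathbb C^*)^2$, where $(\lambda,\mu)\cdot(t_1,t_2;x_1,\dots,x_4)=(\lambda t_1,\lambda t_2;\mu x_1,\lambda^{-1}\mu x_2,\lambda^{-1}\mu x_3,\lambda^{-2}\mu x_4)$, be the four-dimensional scroll with twists $(a_1,a_2,a_3,a_4)=(0,1,1,2)$. Let $\mathcal O_{\mathbb F}(-\tfrac12K_{\mathbb F})$ be its half-anticanonical line bundle; its sections are the polynomials of bidegree $(-1,2)$ in the Cox ring $\mathbb C[t_1,t_2,x_1,\dots,x_4]$, where $\deg t_i=(1,0)$ and $\deg x_j=(-a_j,1)$. There are $20$ monomials $t_1^it_2^jx_mx_n$ ($m\le n$, $i+j=a_m+a_n-1$) of this bidegree. Let $y_{ijmn}$ be corresponding homogeneous coordinates on $\mathbb P^{19}$, and let $$\phi_0\colon \mathbb F(0,1,1,2)\dashrightarrow\mathbb P^{19},\qquad y_{ijmn}=t_1^it_2^jx_mx_n,$$ be the half-anticanonical map, defined where these monomials do not all vanish. Let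 $Q=\overline{\operatorname{im}\phi_0}\subset\mathbb P^{19}$ be the Zariski closure of its image, with its reduced structure, and let $$M_0=\begin{bmatrix} y_{0012}&y_{1022}&y_{1023}&y_{0122}&y_{0123}&y_{2024}&y_{1124}&y_{0224}\\ y_{0013}&y_{1023}&y_{1033}&y_{0123}&y_{0133}&y_{2034}&y_{1134}&y_{0234}\\ y_{1014}&y_{2024}&y_{2034}&y_{1124}&y_{1134}&y_{3044}&y_{2144}&y_{1244}\\ y_{0114}&y_{1124}&y_{1134}&y_{0224}&y_{0234}&y_{2144}&y_{1244}&y_{0344} \end{bmatrix}.$$ 1. $Q$ is cut out scheme-theoretically by the $2\times2$ minors of $M_0$, i.e. $Q=\mathbb V(\wedge^2M_0)$ as closed subschemes of $\mathbb P^{19}$: on each affine chart $\{y\neq0\}$, for $y$ one of the $20$ coordinates, the ideal of $Q$ is generated by the minors divided by $y^2$. 2. The linear subspace $D\subset\mathbb P^{19}$ defined by the vanishing of all coordinates except the four in the first column of $M_0$ is a prime (Weil) divisor in $Q$, that is, $D$ and $Q$ are irreducible, $D\subset Q$, and $D$ has codimension one in $Q$. The linear map $\mathbb P^3\to\mathbb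 P^{19}$ given by these four coordinates is a closed immersion onto $D$, and so $D\cong\mathbb P^3$. 3. The Hilbert polynomial of $Q\subset\mathbb P^{19}$ agrees with that of $\mathbb F(0,1,1,2)$ with respect to $-\tfrac12K_{\mathbb F}$: there is a polynomial $P\in\mathbb Q[m]$ such that $P(m)=\dim_{\mathbb C}\big(\mathbb C[y]/I(Q)\big)_m$ for all sufficiently large $m$, where $I(Q)$ is the homogeneous ideal of $Q$, and $P(m)=\chi\big(\mathbb F,\mathcal O_{\mathbb F}(-\tfrac m2K_{\mathbb F})\big)$ for all integers $m\ge0$. -/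

import Mathlib

open AlgebraicGeometry CategoryTheory MvPolynomial TopologicalSpace

attribute [local instance] MvPolynomial.gradedAlgebra

noncomputable section

/-! ## Projective space as a scheme -/

namespace ProjSp

/-- The homogeneous coordinate ring `ℂ[X_k : k ∈ σ]` with its standard grading. -/
abbrev grading (σ : Type) : ℕ → Submodule ℂ (MvPolynomial σ ℂ) :=
  MvPolynomial.homogeneousSubmodule σ ℂ

/-- The complex projective space with homogeneous coordinates indexed by `σ`, as a scheme. -/
abbrev space (σ : Type) : Scheme := Proj (grading σ)

lemma X_mem (σ : Type) (k : σ) : (X k : MvPolynomial σ ℂ) ∈ grading σ 1 :=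
  MvPolynomial.isHomogeneous_X ℂ k

lemma X_mem_irrelevant (σ : Type) (k : σ) :
    (X k : MvPolynomial σ ℂ) ∈ HomogeneousIdeal.irrelevant (grading σ) :=
  HomogeneousIdeal.mem_irrelevant_of_mem _ one_pos (X_mem σ k)

/-- The closed point `[v]` of projective space with homogeneous coordinates `v ≠ 0`: its
homogeneous prime ideal is generated by the homogeneous polynomials that vanish at `v`. -/
def point {σ : Type} (v : σ → ℂ) (hv : v ≠ 0) : space σ :=
  show ProjectiveSpectrum (grading σ) from
  { asHomogeneousIdeal := (RingHom.ker (MvPolynomial.eval v)).homogeneousCore (grading σ)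
    isPrime := (RingHom.ker_isPrime (MvPolynomial.eval v)).homogeneousCore
    not_irrelevant_le := fun h => by
      obtain ⟨k, hk⟩ := Function.ne_iff.mp hv
      have h1 := Ideal.toIdeal_homogeneousCore_le (grading σ) _ (h (X_mem_irrelevant σ k))
      rw [RingHom.mem_ker, MvPolynomial.eval_X] at h1
      exact hk h1 }

lemma homogeneous_mem_point_iff {σ : Type} (v : σ → ℂ) {d : ℕ}
    {f : MvPolynomial σ ℂ} (hf : f ∈ grading σ d) :
    f ∈ (RingHom.ker (MvPolynomial.eval v)).homogeneousCore (grading σ) ↔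
      MvPolynomial.eval v f = 0 :=
  ⟨fun h => Ideal.toIdeal_homogeneousCore_le (grading σ) _ h,
   fun h => Ideal.mem_homogeneousCore_of_homogeneous_of_mem ⟨d, hf⟩ h⟩

/-- Proportional vectors define the same point. -/
lemma point_eq_of_smul {σ : Type} (v w : σ → ℂ) (hv : v ≠ 0) (hw : w ≠ 0) (c : ℂ)
    (h : w = c • v) : point w hw = point v hv := by
  have hc : c ≠ 0 := by
    rintro rfl
    exact hw (by simpa using h)
  apply ProjectiveSpectrum.ext
  apply HomogeneousIdeal.toIdeal_injective
  refine congrArg HomogeneousIdeal.toIdeal (HomogeneousIdeal.ext' (𝒜 := grading σ) ?_)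
  intro d f hf
  refine (homogeneous_mem_point_iff w hf).trans
    (Iff.trans ?_ (homogeneous_mem_point_iff v hf).symm)
  have key : MvPolynomial.eval w f = c ^ d * MvPolynomial.eval v f := by
    subst h
    rw [MvPolynomial.eval_eq, MvPolynomial.eval_eq, Finset.mul_sum]
    refine Finset.sum_congr rfl fun u hu => ?_
    have hdeg : d = ∑ i ∈ u.support, u i :=
      MvPolynomial.IsHomogeneous.degree_eq_sum_deg_support hf hu
    simp only [Pi.smul_apply, smul_eq_mul, mul_pow, Finset.prod_mul_distrib,
      Finset.prod_pow_eq_pow_sum, ← hdeg]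
    ring
  rw [key]
  simp [hc]

/-- The basic affine open set `D₊(X_k)`. -/
def chart (σ : Type) (k : σ) : (space σ).affineOpens :=
  ⟨Proj.basicOpen (grading σ) (X k),
    Proj.isAffineOpen_basicOpen (grading σ) (X k) (X_mem σ k) one_pos⟩

/-- The ideal of the coordinate ring `ℂ[X_l / X_k : l ∈ σ]` of the `k`-th affine chart that is
generated by the dehomogenizations `f / X_k ^ d` of the homogeneous polynomials `f ∈ s` (where `d`
is the degree of `f`). -/
def dehomogenized {σ : Type} (s : Set (MvPolynomial σ ℂ)) (k : σ) :
    Ideal (HomogeneousLocalization.Away (grading σ) (X k)) :=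
  Ideal.span {a | ∃ f ∈ s, ∃ (d : ℕ) (hf : f ∈ grading σ (d • 1)),
    a = HomogeneousLocalization.Away.mk (grading σ) (X_mem σ k) d f hf}

/-- The closed subscheme of projective space with ideal sheaf `J` is `𝕍(s)`, the closed subscheme
cut out scheme-theoretically by the homogeneous polynomials in `s`: on every standard affine chart
`D₊(X_k) = Spec ℂ[X_l / X_k]` its ideal is generated by the `f / X_k ^ deg f`, `f ∈ s`. (The charts
cover projective space, so this determines `J`.) -/
def IsCutOutBy {σ : Type} (J : (space σ).IdealSheafData) (s : Set (MvPolynomial σ ℂ)) : Prop :=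
  ∀ k : σ, J.ideal (chart σ k) =
    (dehomogenized s k).map (Proj.awayToSection (grading σ) (X k)).hom

/-- The closed subset of projective space where all `f ∈ s` vanish. -/
def zeroSet {σ : Type} (s : Set (MvPolynomial σ ℂ)) : Closeds (space σ) :=
  ⟨ProjectiveSpectrum.zeroLocus (grading σ) s, ProjectiveSpectrum.isClosed_zeroLocus _ s⟩

/-- The homogeneous ideal `I(Z)` of a closed subset of projective space. -/
def homogeneousIdeal {σ : Type} (Z : Closeds (space σ)) : Ideal (MvPolynomial σ ℂ) :=
  (ProjectiveSpectrum.vanishingIdeal (𝒜 := grading σ) (Z : Set (space σ))).toIdeal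

/-- The Hilbert function `d ↦ dim (ℂ[X] / I(Z))_d` of a closed subset (with its reduced
structure). -/
def hilbertFunction {σ : Type} (Z : Closeds (space σ)) (d : ℕ) : ℕ :=
  Module.finrank ℂ (grading σ d ⧸
    ((homogeneousIdeal Z).restrictScalars ℂ).submoduleOf (grading σ d))

/-- `P` is the Hilbert polynomial of the (reduced) closed subscheme `Z` of projective space. -/
def IsHilbertPolynomial {σ : Type} (Z : Closeds (space σ)) (P : Polynomial ℚ) : Prop :=
  ∃ N : ℕ, ∀ d : ℕ, N ≤ d → P.eval (d : ℚ) = hilbertFunction Z d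

/-- For irreducible closed subsets `D ⊆ Q`, that `D` is a prime divisor of `Q`, i.e. has
codimension one in `Q`: `D ≠ Q` and there is no irreducible closed subset strictly between. -/
def IsPrimeDivisor {T : Type*} [TopologicalSpace T] (D Q : Closeds T) : Prop :=
  ∃ (hD : IsIrreducible (D : Set T)) (hQ : IsIrreducible (Q : Set T)),
    (⟨D, hD, D.isClosed⟩ : IrreducibleCloseds T) ⋖ ⟨Q, hQ, Q.isClosed⟩

/-! ### Coordinate linear embeddings -/

/-- For an injection `e` of index sets, the surjection of coordinate rings with `X_{e i} ↦ X_i`,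
and `X_k ↦ 0` for all other `k`. -/
def coordProj {τ σ : Type} (e : τ ↪ σ) : MvPolynomial σ ℂ →ₐ[ℂ] MvPolynomial τ ℂ :=
  MvPolynomial.aeval (Function.extend e (fun i => (X i : MvPolynomial τ ℂ)) (fun _ => 0))

lemma coordProj_X {τ σ : Type} (e : τ ↪ σ) (i : τ) : coordProj e (X (e i)) = X i := by
  simp [coordProj, e.injective.extend_apply]

lemma coordProj_mem {τ σ : Type} (e : τ ↪ σ) {d : ℕ} {f : MvPolynomial σ ℂ}
    (hf : f ∈ grading σ d) : coordProj e f ∈ grading τ d := by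
  have h := MvPolynomial.IsHomogeneous.aeval (R := ℂ) (S := ℂ) (n := 1) hf
    (Function.extend e (fun i => (X i : MvPolynomial τ ℂ)) (fun _ => 0)) (fun k => by
      by_cases hk : ∃ i, e i = k
      · obtain ⟨i, rfl⟩ := hk
        rw [e.injective.extend_apply]
        exact MvPolynomial.isHomogeneous_X ℂ i
      · rw [Function.extend_apply' _ _ _ hk]
        exact MvPolynomial.isHomogeneous_zero _ _ _)
  rw [one_mul] at h
  exact h

/-- `coordProj` as a homomorphism of graded rings. -/
def coordProjGraded {τ σ : Type} (e : τ ↪ σ) :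
    GradedRingHom (grading σ) (grading τ) where
  toRingHom := (coordProj e).toRingHom
  map_mem := fun h => coordProj_mem e h

lemma irrelevant_le {τ σ : Type} (e : τ ↪ σ) :
    HomogeneousIdeal.irrelevant (grading τ) ≤
      (HomogeneousIdeal.irrelevant (grading σ)).map (coordProjGraded e) := by
  refine (HomogeneousIdeal.toIdeal_irrelevant_le (𝒜 := grading τ)
    (I := ((HomogeneousIdeal.irrelevant (grading σ)).map (coordProjGraded e)).toIdeal)).mpr ?_
  intro i hi f hf
  have h1 : MvPolynomial.rename e f ∈ HomogeneousIdeal.irrelevant (grading σ) :=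
    HomogeneousIdeal.mem_irrelevant_of_mem _ hi
      (MvPolynomial.IsHomogeneous.rename_isHomogeneous hf)
  have h2 : coordProj e (MvPolynomial.rename e f) = f := by
    have h3 : (coordProj e).comp (MvPolynomial.rename e) = AlgHom.id ℂ _ := by
      apply MvPolynomial.algHom_ext
      intro j
      simp [coordProj_X]
    exact DFunLike.congr_fun h3 f
  rw [← h2]
  exact Ideal.mem_map_of_mem (coordProjGraded e) h1

/-- The linear embedding of projective spaces onto the linear subspace where all coordinates
outside `e` vanish. -/
def linearEmbedding {τ σ : Type} (e : τ ↪ σ) : space τ ⟶ space σ :=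
  Proj.map (coordProjGraded e) (irrelevant_le e)

end ProjSp

/-! ## Scrolls -/

namespace Scrolls

/-- The open set `U = (ℂ² ∖ 0) × (ℂⁿ ∖ 0)`, with coordinates `(t_1, t_2; x_1, …, x_n)`. -/
structure CoxPoint (n : ℕ) where
  t : Fin 2 → ℂ
  x : Fin n → ℂ
  t_ne : t ≠ 0
  x_ne : x ≠ 0

/-- Two points of `U` are equivalent if they are in the same orbit of the action
`(λ, μ) · (t; x_1, …, x_n) = (λ t; λ ^ (-a_1) μ x_1, …, λ ^ (-a_n) μ x_n)` of `(ℂ^*)²`. -/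
def orbitSetoid {n : ℕ} (a : Fin n → ℤ) : Setoid (CoxPoint n) where
  r p q := ∃ l m : ℂˣ, (∀ i, q.t i = l * p.t i) ∧
    ∀ j, q.x j = ((l ^ (-a j) * m : ℂˣ) : ℂ) * p.x j
  iseqv :=
    { refl := fun p => ⟨1, 1, by simp, by simp⟩
      symm := by
        rintro p q ⟨l, m, ht, hx⟩
        refine ⟨l⁻¹, m⁻¹, fun i => ?_, fun j => ?_⟩
        · rw [ht i]; simp
        · rw [hx j, ← mul_assoc, ← Units.val_mul]
          have : (l⁻¹ ^ (-a j) * m⁻¹ * (l ^ (-a j) * m) : ℂˣ) = 1 := by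
            rw [inv_zpow, mul_mul_mul_comm, inv_mul_cancel, inv_mul_cancel, one_mul]
          rw [this]; simp
      trans := by
        rintro p q r ⟨l, m, ht, hx⟩ ⟨l', m', ht', hx'⟩
        refine ⟨l' * l, m' * m, fun i => ?_, fun j => ?_⟩
        · rw [ht' i, ht i]; push_cast; ring
        · rw [hx' j, hx j, ← mul_assoc, ← Units.val_mul, mul_zpow]
          congr 2
          exact mul_mul_mul_comm _ _ _ _ }

/-- The (complex points of the) scroll `𝔽(a_1, …, a_n) = U / (ℂ^*)²`, all weights being `1`. -/
def Scroll {n : ℕ} (a : Fin n → ℤ) : Type := Quotient (orbitSetoid a)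

/-! ### Line bundles on scrolls and their cohomology

A class `D = (d, e)` in `ℤ²` stands for the divisor class `d L + e M`, where `L = {t_i = 0}` and
`M` is the class for which `x_j` is a section of `-a_j L + M`. On the Cox ring
`S = ℂ[t_1, t_2, x_1, …, x_n]` this is the bigrading with `deg t_i = (1, 0)` and
`deg x_j = (-a_j, 1)`. -/

/-- The Cox variables: `inl i` is `t_{i+1}`, `inr j` is `x_{j+1}`. -/
abbrev CoxVar (n : ℕ) : Type := Fin 2 ⊕ Fin n

/-- The bidegree of a Cox variable. -/
def varDegree {n : ℕ} (a : Fin n → ℤ) : CoxVar n → ℤ × ℤ :=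
  Sum.elim (fun _ => (1, 0)) (fun j => (-a j, 1))

/-- The bidegree of a Laurent monomial in the Cox variables. -/
def bidegree {n : ℕ} (a : Fin n → ℤ) (u : CoxVar n → ℤ) : ℤ × ℤ :=
  ∑ v, u v • varDegree a v

/-- The anticanonical class: the sum of the classes of all the toric divisors. -/
def anticanonical {n : ℕ} (a : Fin n → ℤ) : ℤ × ℤ := ∑ v, varDegree a v

/-- Laurent polynomials over `K` in the Cox variables (a Laurent monomial is given by its exponents). -/
abbrev Laurent (K : Type) [Field K] (n : ℕ) : Type := (CoxVar n → ℤ) →₀ K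

instance instAddCommGroupLaurent (K : Type) [Field K] (n : ℕ) : AddCommGroup (Laurent K n) :=
  Finsupp.instAddCommGroup

/-- The index set of the standard open affine cover of the scroll: `(i, j)` stands for the chart
`U_{ij} = {t_i x_j ≠ 0}`. -/
abbrev ChartIdx (n : ℕ) : Type := Fin 2 × Fin n

/-- A Cox variable that is invertible on the intersection of the charts in the list `s`. -/
def InvertibleOn {n p : ℕ} (s : Fin p → ChartIdx n) : CoxVar n → Prop :=
  Sum.elim (fun i => ∃ k, (s k).1 = i) (fun j => ∃ k, (s k).2 = j)

/-- The sections of the line bundle `𝒪(D)` on the intersection `W` of the charts in the list `s`: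
the part of degree `D` of the localization of `S` at the Cox variables that are invertible
on `W`. -/
def sections (K : Type) [Field K] {n p : ℕ} (a : Fin n → ℤ) (D : ℤ × ℤ) (s : Fin p → ChartIdx n) :
    Submodule K (Laurent K n) :=
  Finsupp.supported K K {u | bidegree a u = D ∧ ∀ v, u v < 0 → InvertibleOn s v}

/-- The Čech `p`-cochains of `𝒪(D)` for the standard affine cover. -/
def cochains (K : Type) [Field K] {n : ℕ} (a : Fin n → ℤ) (D : ℤ × ℤ) (p : ℕ) :
    Submodule K ((Fin (p + 1) → ChartIdx n) → Laurent K n) :=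
  Submodule.pi Set.univ (fun s => sections K a D s)

/-- The Čech differential `(δ c)(s) = ∑ₖ (-1)ᵏ c(s with its k-th entry removed)`. -/
def delta (K : Type) [Field K] (n p : ℕ) : ((Fin (p + 1) → ChartIdx n) → Laurent K n) →ₗ[K]
    ((Fin (p + 2) → ChartIdx n) → Laurent K n) :=
  LinearMap.pi fun s => ∑ k : Fin (p + 2),
    ((-1 : K) ^ (k : ℕ)) • LinearMap.proj (fun i => s (k.succAbove i))

/-- The Čech `p`-cocycles of `𝒪(D)`. -/
def cocycles (K : Type) [Field K] {n : ℕ} (a : Fin n → ℤ) (D : ℤ × ℤ) (p : ℕ) :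
    Submodule K ((Fin (p + 1) → ChartIdx n) → Laurent K n) :=
  cochains K a D p ⊓ LinearMap.ker (delta K n p)

/-- The Čech `p`-coboundaries of `𝒪(D)`. -/
def coboundaries (K : Type) [Field K] {n : ℕ} (a : Fin n → ℤ) (D : ℤ × ℤ) : (p : ℕ) →
    Submodule K ((Fin (p + 1) → ChartIdx n) → Laurent K n)
  | 0 => ⊥
  | p + 1 => (cochains K a D p).map (delta K n p)

/-- The cohomology group `H^p(𝔽, 𝒪(D))`, as Čech cohomology of the standard affine cover. -/
abbrev Cohomology (K : Type) [Field K] {n : ℕ} (a : Fin n → ℤ) (D : ℤ × ℤ) (p : ℕ) : Type :=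
  cocycles K a D p ⧸ (coboundaries K a D p).submoduleOf (cocycles K a D p)

/-- `χ(𝔽, 𝒪(D)) = ∑ₚ (-1)ᵖ dim H^p(𝔽, 𝒪(D))` is defined and equal to `c`: the cohomology groups are
finite-dimensional, almost all are zero, and the alternating sum of the dimensions is `c`. -/
def HasEulerChar (K : Type) [Field K] {n : ℕ} (a : Fin n → ℤ) (D : ℤ × ℤ) (c : ℤ) : Prop :=
  (∀ p, Module.Finite K (Cohomology K a D p)) ∧
  ∃ N : ℕ, (∀ p, N ≤ p → Subsingleton (Cohomology K a D p)) ∧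
    c = ∑ p ∈ Finset.range N, (-1) ^ p * (Module.finrank K (Cohomology K a D p) : ℤ)

/-- `P` is the Hilbert polynomial of the scroll (over the field `K`) with respect to the class `D`:
`P(m) = χ(𝔽, 𝒪(m D))`. -/
def IsHilbertPolynomial (K : Type) [Field K] {n : ℕ} (a : Fin n → ℤ) (D : ℤ × ℤ) (P : Polynomial ℚ) : Prop :=
  ∀ m : ℕ, ∃ c : ℤ, HasEulerChar K a (m • D) c ∧ P.eval (m : ℚ) = c

end Scrolls

/-! ## The half-anticanonical map of `𝔽(0, 1, 1, 2)` -/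

namespace HalfAnti

open ProjSp Scrolls

/-- The twists of the scroll `𝔽(0, 1, 1, 2)`. -/
def twists : Fin 4 → ℤ := ![0, 1, 1, 2]

/-- The class of `-K/2` on `𝔽(0, 1, 1, 2)`. -/
def halfAnticanonical : ℤ × ℤ := (-1, 2)

lemma two_nsmul_halfAnticanonical : 2 • halfAnticanonical = anticanonical twists := by
  simp [halfAnticanonical, anticanonical, varDegree, twists, Fin.sum_univ_succ]

/-- The homogeneous coordinates `y_{ijmn}` of `ℙ¹⁹`. -/
inductive Coord : Type
  | y0012 | y0013
  | y1014 | y0114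
  | y1022 | y0122 | y1023 | y0123 | y1033 | y0133
  | y2024 | y1124 | y0224
  | y2034 | y1134 | y0234
  | y3044 | y2144 | y1244 | y0344
  deriving DecidableEq

open Coord

/-- The indices of `y_{ijmn}`; the indices `m`, `n` of the variables `x` are shifted by one. -/
def Coord.idx : Coord → ℕ × ℕ × Fin 4 × Fin 4
  | y0012 => (0, 0, 0, 1) | y0013 => (0, 0, 0, 2)
  | y1014 => (1, 0, 0, 3) | y0114 => (0, 1, 0, 3)
  | y1022 => (1, 0, 1, 1) | y0122 => (0, 1, 1, 1)
  | y1023 => (1, 0, 1, 2) | y0123 => (0, 1, 1, 2)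
  | y1033 => (1, 0, 2, 2) | y0133 => (0, 1, 2, 2)
  | y2024 => (2, 0, 1, 3) | y1124 => (1, 1, 1, 3) | y0224 => (0, 2, 1, 3)
  | y2034 => (2, 0, 2, 3) | y1134 => (1, 1, 2, 3) | y0234 => (0, 2, 2, 3)
  | y3044 => (3, 0, 3, 3) | y2144 => (2, 1, 3, 3) | y1244 => (1, 2, 3, 3) | y0344 => (0, 3, 3, 3)

/-- The map `(t; x) ↦ (y_{ijmn})`, `y_{ijmn} = t_1^i t_2^j x_m x_n`. -/
def coxMap (p : CoxPoint 4) : Coord → ℂ := fun k =>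
  p.t 0 ^ k.idx.1 * p.t 1 ^ k.idx.2.1 * p.x k.idx.2.2.1 * p.x k.idx.2.2.2

/-- The functions `y_{ijmn}` are homogeneous of bidegree `-K/2`. -/
lemma coxMap_smul {p q : CoxPoint 4} {l m : ℂˣ} (ht : ∀ i, q.t i = l * p.t i)
    (hx : ∀ j, q.x j = ((l ^ (-twists j) * m : ℂˣ) : ℂ) * p.x j) :
    coxMap q = ((l ^ (-1 : ℤ) * m ^ 2 : ℂˣ) : ℂ) • coxMap p := by
  have hl : (l : ℂ) ≠ 0 := l.ne_zero
  funext k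
  cases k <;>
    simp [coxMap, Coord.idx, ht, hx, twists] <;> field_simp

/-- The indeterminacy locus of the half-anticanonical map: the points where all the sections
`y_{ijmn}` vanish. -/
def indeterminacy : Set (Scroll twists) :=
  {P | ∃ p : CoxPoint 4, Quotient.mk (orbitSetoid twists) p = P ∧ coxMap p = 0}

/-- The half-anticanonical map `φ₀ : 𝔽(0, 1, 1, 2) ⇢ ℙ¹⁹` on its domain of definition, in Cox
coordinates `(t; x) ↦ (y_{ijmn})`; see `phi0_mk`. -/
def phi0 (P : {P : Scroll twists // P ∉ indeterminacy}) : space Coord :=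
  point (coxMap (Quotient.out P.1)) (fun h => P.2 ⟨Quotient.out P.1, Quotient.out_eq P.1, h⟩)

lemma phi0_mk (p : CoxPoint 4) (hp : coxMap p ≠ 0)
    (hP : Quotient.mk (orbitSetoid twists) p ∉ indeterminacy) :
    phi0 ⟨Quotient.mk (orbitSetoid twists) p, hP⟩ = point (coxMap p) hp := by
  obtain ⟨l, m, ht, hx⟩ : (orbitSetoid twists).r p
      (Quotient.out (Quotient.mk (orbitSetoid twists) p)) :=
    (orbitSetoid twists).symm (Quotient.mk_out p)
  exact point_eq_of_smul _ _ hp _ _ (coxMap_smul ht hx)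

/-- `Q ⊆ ℙ¹⁹`, the Zariski closure of the image of `φ₀`. -/
def Q : Closeds (space Coord) := Closeds.closure (Set.range phi0)

/-- The indices of the entries of the matrix `M₀`. -/
def M0idx : Matrix (Fin 4) (Fin 8) Coord :=
  !![y0012, y1022, y1023, y0122, y0123, y2024, y1124, y0224;
     y0013, y1023, y1033, y0123, y0133, y2034, y1134, y0234;
     y1014, y2024, y2034, y1124, y1134, y3044, y2144, y1244;
     y0114, y1124, y1134, y0224, y0234, y2144, y1244, y0344]

/-- The matrix `M₀` of homogeneous coordinates. -/
def M0 : Matrix (Fin 4) (Fin 8) (MvPolynomial Coord ℂ) := M0idx.map X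

/-- The set of the `2 × 2` minors of a matrix. -/
def minors2 {m n : ℕ} {R : Type*} [CommRing R] (M : Matrix (Fin m) (Fin n) R) : Set R :=
  {f | ∃ i i' : Fin m, ∃ j j' : Fin n, i < i' ∧ j < j' ∧
    f = (M.submatrix ![i, i'] ![j, j']).det}

/-- The four coordinates in the first column of `M₀`. -/
def firstColumn : Fin 4 ↪ Coord := ⟨fun i => M0idx i 0, by decide⟩

/-- The homogeneous coordinates that do not occur in the first column of `M₀`. -/
def otherVariables : Set (MvPolynomial Coord ℂ) :=
  {f | ∃ k : Coord, k ∉ Set.range firstColumn ∧ f = X k}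

/-- The linear subspace `D ⊆ ℙ¹⁹` where all coordinates outside the first column vanish. -/
def D : Closeds (space Coord) := zeroSet otherVariables

end HalfAnti

end

/-!
# The half-anticanonical image of the scroll `𝔽(0, 1, 1, 2)`

The coordinates pull back to monomials of the Cox ring (`torusMap`), and `I(Q)` is the kernel of
this homomorphism (`homogeneousIdeal_Q`). The matrix `M₀` pulls back to the product of the column
`r = (x₂, x₃, t₁x₄, t₂x₄)` with the row `(x₁, t_k r_i)`, so its minors are in `I(Q)`. Conversely,
`Q` is parametrized by `(r, T, c)` with `r₃ T₂ = r₄ T₁`, where the first column of `M₀` is `r_i c`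
and the other entries are `T_k r_i r_j` (`cone`). Relations in `I(Q)` hold identically for this
parametrization: this is clear after multiplication by a power of `T₁`, and `T₁` is a
nonzerodivisor modulo `r₃ T₂ - r₄ T₁` (`coneRel_dvd`). Over any ring, a point that satisfies the
minors and has an invertible coordinate has parameters: `r` is the column of the invertible entry,
and `T`, `c` come from its row. So it satisfies all relations in `I(Q)`
(`aeval_eq_zero_of_rank_one`), and the minors cut out `Q` scheme-theoretically
(`isCutOutBy_minors`).

The divisor `D` is the image of `T = 0`, so it lies in `Q`. A prime between `I(Q)` and `I(D)`
contains no entry of the first column of `M₀`; if it contains `y₁₀₂₂`, then by the minors it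
contains all coordinates outside the first column. So `I(D)` is minimal over `I(Q) + (y₁₀₂₂)`, and
Krull's principal ideal theorem bounds the codimension (`isPrimeDivisor_D`).

The homogeneous coordinate ring of `Q` in degree `d` has a basis of the monomials of bidegree
`(-d, 2d)` in the Cox ring whose degree in `x₁` is at most `d` (`hilbertFunction_Q`). The Čech
complex of a line bundle on the scroll splits into complexes for the Laurent monomials; for
nonnegative degree on the fibres, `H⁰` has a basis of the monomials, `H¹` of the Laurent monomials
with both `t`-exponents negative and no `x`-exponent negative, and the other groups vanish
(`hasEulerChar`). For fixed exponents of the `x_j`, the monomials in `t` contribute the Euler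
characteristic of a line bundle on `ℙ¹`, a polynomial. So both numbers are sums of the same
polynomial, over `s ≤ 2m` for the scroll and over `m ≤ s ≤ 2m` for `Q`, where `s` is the degree in
`x₂, x₃, x₄`. The sum over `s < m` is zero, and both sums are `(m + 1)² (2m + 1) (2m + 3) / 3`
(`hilbertPoly`).
-/

noncomputable section

namespace HalfAnti

open ProjSp Scrolls Coord

/-! ### The matrix `M₀` and the toric parametrization -/

/-- The column of `M₀` that stands for `t_k · r_i`, where `r = (x₂, x₃, t₁x₄, t₂x₄)` labels the
rows. The columns `t₁ · r₄` and `t₂ · r₃` coincide. -/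
def col (k : Fin 2) (i : Fin 4) : Fin 8 := !![1, 2, 5, 6; 3, 4, 6, 7] k i

lemma M0idx_col_symm (k : Fin 2) (i i' : Fin 4) :
    M0idx i (col k i') = M0idx i' (col k i) := by
  revert k i i'; decide

lemma coord_cases (l : Coord) :
    (∃ i, l = M0idx i 0) ∨ ∃ k i i', l = M0idx i (col k i') := by
  cases l
  case y0012 => exact .inl ⟨0, rfl⟩
  case y0013 => exact .inl ⟨1, rfl⟩
  case y1014 => exact .inl ⟨2, rfl⟩
  case y0114 => exact .inl ⟨3, rfl⟩
  case y1022 => exact .inr ⟨0, 0, 0, rfl⟩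
  case y0122 => exact .inr ⟨1, 0, 0, rfl⟩
  case y1023 => exact .inr ⟨0, 0, 1, rfl⟩
  case y0123 => exact .inr ⟨1, 0, 1, rfl⟩
  case y1033 => exact .inr ⟨0, 1, 1, rfl⟩
  case y0133 => exact .inr ⟨1, 1, 1, rfl⟩
  case y2024 => exact .inr ⟨0, 0, 2, rfl⟩
  case y1124 => exact .inr ⟨0, 0, 3, rfl⟩
  case y0224 => exact .inr ⟨1, 0, 3, rfl⟩
  case y2034 => exact .inr ⟨0, 1, 2, rfl⟩
  case y1134 => exact .inr ⟨0, 1, 3, rfl⟩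
  case y0234 => exact .inr ⟨1, 1, 3, rfl⟩
  case y3044 => exact .inr ⟨0, 2, 2, rfl⟩
  case y2144 => exact .inr ⟨0, 2, 3, rfl⟩
  case y1244 => exact .inr ⟨1, 2, 3, rfl⟩
  case y0344 => exact .inr ⟨1, 3, 3, rfl⟩

/-- The coordinate ring version of `coxMap`: the homomorphism
`y_{ijmn} ↦ t_1^i t_2^j x_m x_n` to the Cox ring. -/
def torusMap : MvPolynomial Coord ℂ →ₐ[ℂ] MvPolynomial (CoxVar 4) ℂ :=
  aeval fun l => X (.inl 0) ^ l.idx.1 * X (.inl 1) ^ l.idx.2.1 *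
    X (.inr l.idx.2.2.1) * X (.inr l.idx.2.2.2)

/-- The values of the coordinates `y` if the entries of the first column of `M₀` are `r_i c` and
the entries of the column `t_k r_{i'}` are `T_k r_i r_{i'}`. With parameters subject to
`r₃ T₂ = r₄ T₁`, this parametrizes `Q`, and `D` is the image of `T = 0`. -/
def cone {A : Type*} [CommRing A] (r : Fin 4 → A) (T : Fin 2 → A) (c : A) : Coord → A
  | y0012 => r 0 * c | y0013 => r 1 * c
  | y1014 => r 2 * c | y0114 => r 3 * c
  | y1022 => T 0 * r 0 * r 0 | y0122 => T 1 * r 0 * r 0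
  | y1023 => T 0 * r 0 * r 1 | y0123 => T 1 * r 0 * r 1
  | y1033 => T 0 * r 1 * r 1 | y0133 => T 1 * r 1 * r 1
  | y2024 => T 0 * r 0 * r 2 | y1124 => T 0 * r 0 * r 3 | y0224 => T 1 * r 0 * r 3
  | y2034 => T 0 * r 1 * r 2 | y1134 => T 0 * r 1 * r 3 | y0234 => T 1 * r 1 * r 3
  | y3044 => T 0 * r 2 * r 2 | y2144 => T 0 * r 2 * r 3 | y1244 => T 1 * r 2 * r 3
  | y0344 => T 1 * r 3 * r 3

lemma map_cone {A B : Type*} [CommRing A] [CommRing B] [Algebra ℂ A] [Algebra ℂ B]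
    (g : A →ₐ[ℂ] B) (r : Fin 4 → A) (T : Fin 2 → A) (c : A) (l : Coord) :
    g (cone r T c l) = cone (fun i => g (r i)) (fun k => g (T k)) (g c) l := by
  cases l <;> simp [cone]

lemma cone_M0idx_zero {A : Type*} [CommRing A] (r : Fin 4 → A) (T : Fin 2 → A) (c : A)
    (i : Fin 4) : cone r T c (M0idx i 0) = r i * c := by
  fin_cases i <;> rfl

lemma cone_M0idx_col {A : Type*} [CommRing A] (r : Fin 4 → A) (T : Fin 2 → A) (c : A)
    (h : r 2 * T 1 = r 3 * T 0) (k : Fin 2) (i i' : Fin 4) :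
    cone r T c (M0idx i (col k i')) = T k * r i * r i' := by
  fin_cases k <;> fin_cases i <;> fin_cases i' <;>
    simp only [M0idx, col, cone, Matrix.of_apply, Matrix.cons_val, Fin.mk_zero, Fin.mk_one,
      Fin.reduceFinMk, Fin.isValue] <;>
    grind

lemma aeval_mul_of_mem_grading {σ A : Type} [CommRing A] [Algebra ℂ A] {d : ℕ}
    {f : MvPolynomial σ ℂ} (hf : f ∈ grading σ d) (c : A) (Y : σ → A) :
    aeval (fun l => c * Y l) f = c ^ d * aeval Y f := by
  rw [aeval_def, aeval_def, eval₂_eq, eval₂_eq, Finset.mul_sum]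
  refine Finset.sum_congr rfl fun u hu => ?_
  have hdeg : d = ∑ i ∈ u.support, u i :=
    MvPolynomial.IsHomogeneous.degree_eq_sum_deg_support hf hu
  simp only [mul_pow, Finset.prod_mul_distrib, Finset.prod_pow_eq_pow_sum, ← hdeg]
  ring

/-- After multiplication by `T₁²`, the parametrization `cone` factors through the Cox ring of the
scroll, by `t = T`, `x = (c T₁, r₁ T₁, r₂ T₁, r₃)`. Hence relations between the monomials
`y_{ijmn}` hold for `cone`, up to a power of `T₁`. -/
lemma cone_relation_of_torusMap {A : Type} [CommRing A] [Algebra ℂ A] (r : Fin 4 → A)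
    (T : Fin 2 → A) (c : A) (h : r 2 * T 1 = r 3 * T 0) {d : ℕ} {f : MvPolynomial Coord ℂ}
    (hf : f ∈ grading Coord d) (h0 : torusMap f = 0) :
    T 0 ^ (2 * d) * aeval (cone r T c) f = 0 := by
  rw [pow_mul, ← aeval_mul_of_mem_grading hf]
  have key : (aeval fun l => T 0 ^ 2 * cone r T c l : MvPolynomial Coord ℂ →ₐ[ℂ] A) =
      (aeval (Sum.elim T ![c * T 0, r 0 * T 0, r 1 * T 0, r 2]) :
        MvPolynomial (CoxVar 4) ℂ →ₐ[ℂ] A).comp torusMap := by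
    apply MvPolynomial.algHom_ext
    intro l
    cases l <;> simp only [torusMap, AlgHom.comp_apply, aeval_X, map_mul, map_pow, idx, cone,
      Sum.elim_inl, Sum.elim_inr, Matrix.cons_val] <;> grind
  rw [key, AlgHom.comp_apply, h0, map_zero]

/-- The universal coordinates `r₁, …, r₄, T₁, T₂, c` of the parametrization `cone`. -/
abbrev ConeVar : Type := Fin 4 ⊕ Fin 2 ⊕ Unit

/-- The relation between the universal coordinates. -/
def coneRel : MvPolynomial ConeVar ℂ :=
  X (.inl 2) * X (.inr (.inl 1)) - X (.inl 3) * X (.inr (.inl 0))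

/-- Relations between the `y` on the scroll hold for the universal `cone`: as
`T₁` is a prime element that does not divide the relation, the factor `T₁²ᵈ` can be cancelled. -/
lemma coneRel_dvd {d : ℕ} {f : MvPolynomial Coord ℂ} (hf : f ∈ grading Coord d)
    (h0 : torusMap f = 0) :
    coneRel ∣ aeval (cone (fun i => X (.inl i)) (fun k => X (.inr (.inl k)))
      (X (.inr (.inr ()))) : Coord → MvPolynomial ConeVar ℂ) f := by
  set g := aeval (cone (fun i => X (.inl i)) (fun k => X (.inr (.inl k)))
      (X (.inr (.inr ()))) : Coord → MvPolynomial ConeVar ℂ) f with hg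
  let π := Ideal.Quotient.mkₐ ℂ (Ideal.span {coneRel})
  have h1 := cone_relation_of_torusMap (A := MvPolynomial ConeVar ℂ ⧸ Ideal.span {coneRel})
    (fun i => π (X (.inl i))) (fun k => π (X (.inr (.inl k)))) (π (X (.inr (.inr ()))))
    (by
      rw [← sub_eq_zero, ← map_mul, ← map_mul, ← map_sub]
      exact Ideal.Quotient.eq_zero_iff_mem.mpr (Ideal.mem_span_singleton_self _)) hf h0
  have h2 : (aeval (cone (fun i => π (X (.inl i))) (fun k => π (X (.inr (.inl k))))
      (π (X (.inr (.inr ()))))) : MvPolynomial Coord ℂ →ₐ[ℂ] _) =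
      π.comp (aeval (cone (fun i => X (.inl i)) (fun k => X (.inr (.inl k)))
        (X (.inr (.inr ()))))) := by
    apply MvPolynomial.algHom_ext
    intro l
    simp only [AlgHom.comp_apply, aeval_X]
    exact (map_cone π _ _ _ l).symm
  rw [h2, AlgHom.comp_apply, ← hg, ← map_pow, ← map_mul] at h1
  obtain ⟨q, hq⟩ := Ideal.mem_span_singleton.mp (Ideal.Quotient.eq_zero_iff_mem.mp h1)
  have hX : Prime (X (.inr (.inl 0)) : MvPolynomial ConeVar ℂ) := X_prime
  -- at `r = (1, 1, 1, 1)`, `T = (0, 1)` the relation has the value `1`, but `T₁` vanishes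
  have hnd : ¬ (X (.inr (.inl 0)) : MvPolynomial ConeVar ℂ) ∣ coneRel := by
    rintro ⟨s, hs⟩
    have := congrArg (MvPolynomial.eval (Sum.elim (fun _ => (1 : ℂ))
      (Sum.elim ![0, 1] fun _ => 0))) hs
    simp [coneRel] at this
  obtain ⟨s, rfl⟩ := hX.pow_dvd_of_dvd_mul_left (2 * d) hnd ⟨g, hq.symm⟩
  refine ⟨s, mul_left_cancel₀ (pow_ne_zero (2 * d) hX.ne_zero) (hq.trans ?_)⟩
  ring

lemma aeval_cone_eq_zero {B : Type} [CommRing B] [Algebra ℂ B] (r : Fin 4 → B) (T : Fin 2 → B)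
    (c : B) (h : r 2 * T 1 = r 3 * T 0) {d : ℕ} {f : MvPolynomial Coord ℂ}
    (hf : f ∈ grading Coord d) (h0 : torusMap f = 0) : aeval (cone r T c) f = 0 := by
  obtain ⟨q, hq⟩ := coneRel_dvd hf h0
  let ev : MvPolynomial ConeVar ℂ →ₐ[ℂ] B := aeval (Sum.elim r (Sum.elim T fun _ => c))
  have h2 : (aeval (cone r T c) : MvPolynomial Coord ℂ →ₐ[ℂ] B) =
      ev.comp (aeval (cone (fun i => X (.inl i)) (fun k => X (.inr (.inl k)))
        (X (.inr (.inr ()))))) := by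
    apply MvPolynomial.algHom_ext
    intro l
    simp only [AlgHom.comp_apply, aeval_X]
    refine Eq.trans ?_ (map_cone ev _ _ _ l).symm
    simp [ev]
  have h3 : ev coneRel = 0 := by simp [ev, coneRel, h]
  rw [h2, AlgHom.comp_apply, hq, map_mul, h3, zero_mul]

/-- If the values `Y` of the coordinates satisfy the relations of the `2 × 2` minors of `M₀` and one
of them is a unit, then they satisfy all relations that hold on the scroll. This is the reason why
the minors cut out `Q` scheme-theoretically. -/
theorem aeval_eq_zero_of_rank_one {B : Type} [CommRing B] [Algebra ℂ B] (Y : Coord → B)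
    (hY : ∀ i i' j j', Y (M0idx i j) * Y (M0idx i' j') = Y (M0idx i j') * Y (M0idx i' j))
    (l : Coord) (hl : IsUnit (Y l)) {d : ℕ} {f : MvPolynomial Coord ℂ}
    (hf : f ∈ grading Coord d) (h0 : torusMap f = 0) : aeval Y f = 0 := by
  obtain ⟨i₀, j₀, rfl⟩ : ∃ i j, l = M0idx i j := by
    rcases coord_cases l with ⟨i, h⟩ | ⟨k, i, i', h⟩
    exacts [⟨i, 0, h⟩, ⟨i, _, h⟩]
  set u := Y (M0idx i₀ j₀) with hu
  -- the column of the unit entry gives `r`, its row gives `T` and `c`, up to factors `u`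
  let r : Fin 4 → B := fun i => Y (M0idx i j₀)
  let T : Fin 2 → B := fun k => Y (M0idx i₀ (col k i₀))
  let c : B := u * Y (M0idx i₀ 0)
  have hrel : r 2 * T 1 = r 3 * T 0 := by
    have h : M0idx i₀ (col 1 2) = M0idx i₀ (col 0 3) := rfl
    have h1 := hY 2 i₀ j₀ (col 1 i₀)
    have h2 := hY 3 i₀ j₀ (col 0 i₀)
    rw [M0idx_col_symm 1 2 i₀, h] at h1
    rw [M0idx_col_symm 0 3 i₀] at h2
    exact h1.trans h2.symm
  have hcone : ∀ l, cone r T c l = u ^ 2 * Y l := by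
    intro l
    rcases coord_cases l with ⟨i, rfl⟩ | ⟨k, i, i', rfl⟩
    · rw [cone_M0idx_zero]
      linear_combination u * hY i i₀ j₀ 0
    · rw [cone_M0idx_col _ _ _ hrel]
      have h1 := hY i i₀ j₀ (col k i')
      have h2 := hY i' i₀ j₀ (col k i₀)
      rw [M0idx_col_symm k i' i₀] at h2
      linear_combination r i * h2 + u * h1
  have h1 := aeval_cone_eq_zero r T c hrel hf h0
  rw [show cone r T c = fun l => u ^ 2 * Y l from funext hcone, aeval_mul_of_mem_grading hf] at h1
  exact ((hl.pow 2).pow d).mul_right_eq_zero.mp h1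

end HalfAnti

namespace ProjSp

/-! ### Ideal sheaves of irreducible closed subsets of projective space -/

variable {σ : Type}

/-- The coordinate ring of a standard affine chart as a `ℂ`-algebra. -/
instance awayAlgebra (k : σ) :
    Algebra ℂ (HomogeneousLocalization.Away (grading σ) (X k)) :=
  ((algebraMap (grading σ 0) _).comp (algebraMap ℂ (grading σ 0))).toAlgebra

lemma val_algebraMap_away (k : σ) (z : ℂ) :
    (algebraMap ℂ (HomogeneousLocalization.Away (grading σ) (X k)) z).val =
      algebraMap (MvPolynomial σ ℂ) (Localization.Away (X k : MvPolynomial σ ℂ)) (C z) := by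
  rfl

/-- The dehomogenization `X_l ↦ X_l / X_k` onto the coordinate ring of the `k`-th chart. -/
def dehomogenize (k : σ) :
    MvPolynomial σ ℂ →ₐ[ℂ] HomogeneousLocalization.Away (grading σ) (X k) :=
  aeval fun l => HomogeneousLocalization.Away.mk (grading σ) (X_mem σ k) 1 (X l)
    (by simpa using X_mem σ l)

lemma dehomogenize_X_self (k : σ) : dehomogenize k (X k) = 1 := by
  rw [dehomogenize, aeval_X]
  apply HomogeneousLocalization.val_injective
  rw [HomogeneousLocalization.Away.val_mk, HomogeneousLocalization.val_one]
  simp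

lemma dehomogenize_eq_mk (k : σ) {d : ℕ} {f : MvPolynomial σ ℂ} (hf : f ∈ grading σ (d • 1)) :
    dehomogenize k f = HomogeneousLocalization.Away.mk (grading σ) (X_mem σ k) d f hf := by
  apply HomogeneousLocalization.val_injective
  rw [HomogeneousLocalization.Away.val_mk, Localization.mk_eq_mk', eq_comm,
    IsLocalization.mk'_eq_iff_eq_mul, mul_comm]
  let v : HomogeneousLocalization.Away (grading σ) (X k) →ₐ[ℂ]
      Localization.Away (X k : MvPolynomial σ ℂ) :=
    { toFun := HomogeneousLocalization.val
      map_one' := HomogeneousLocalization.val_one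
      map_mul' := HomogeneousLocalization.val_mul
      map_zero' := HomogeneousLocalization.val_zero
      map_add' := HomogeneousLocalization.val_add
      commutes' := fun z => by
        rw [val_algebraMap_away, IsScalarTower.algebraMap_apply ℂ (MvPolynomial σ ℂ)]
        rfl }
  have hv : v (dehomogenize k f) = (dehomogenize k f).val := rfl
  rw [← hv, dehomogenize, ← AlgHom.comp_apply, comp_aeval, map_pow]
  have hd : f ∈ grading σ d := by simpa using hf
  rw [← HalfAnti.aeval_mul_of_mem_grading hd]
  have h : (aeval fun l => algebraMap (MvPolynomial σ ℂ) (Localization.Away (X k)) (X k) *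
      v (HomogeneousLocalization.Away.mk (grading σ) (X_mem σ k) 1 (X l)
        (by simpa using X_mem σ l)) :
      MvPolynomial σ ℂ →ₐ[ℂ] Localization.Away (X k : MvPolynomial σ ℂ)) =
      IsScalarTower.toAlgHom ℂ (MvPolynomial σ ℂ) _ := by
    apply MvPolynomial.algHom_ext
    intro l
    rw [aeval_X]
    change _ * (HomogeneousLocalization.Away.mk (grading σ) (X_mem σ k) 1 (X l) _).val = _
    rw [HomogeneousLocalization.Away.val_mk, Localization.mk_eq_mk',
      IsLocalization.mul_mk'_eq_mk'_of_mul]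
    change _ = algebraMap _ _ _
    rw [IsLocalization.mk'_eq_iff_eq_mul, ← map_mul]
    simp only [pow_one, mul_comm]
  exact (DFunLike.congr_fun h f).symm

lemma exists_dehomogenize_eq (k : σ) (a : HomogeneousLocalization.Away (grading σ) (X k)) :
    ∃ d, ∃ f ∈ grading σ d, dehomogenize k f = a := by
  obtain ⟨d, f, hf, rfl⟩ := HomogeneousLocalization.Away.mk_surjective (grading σ) (X_mem σ k) a
  exact ⟨d, f, by simpa using hf, dehomogenize_eq_mk k hf⟩

lemma dehomogenized_eq_map {s : Set (MvPolynomial σ ℂ)} (hs : ∀ f ∈ s, ∃ d, f ∈ grading σ d)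
    (k : σ) : dehomogenized s k = (Ideal.span s).map (dehomogenize k) := by
  rw [Ideal.map_span, dehomogenized]
  congr 1
  ext a
  constructor
  · rintro ⟨f, hf, d, hd, rfl⟩
    exact ⟨f, hf, dehomogenize_eq_mk k hd⟩
  · rintro ⟨f, hf, rfl⟩
    obtain ⟨d, hd⟩ := hs f hf
    have hd' : f ∈ grading σ (d • 1) := by simpa using hd
    exact ⟨f, hf, d, hd', dehomogenize_eq_mk k hd'⟩

lemma isUnit_mapId_dehomogenize {k : σ} (η : ProjectiveSpectrum (grading σ))
    (hk : (X k : MvPolynomial σ ℂ) ∈ η.asHomogeneousIdeal.toIdeal.primeCompl) {d : ℕ}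
    {f : MvPolynomial σ ℂ} (hf : f ∈ grading σ d) :
    IsUnit (HomogeneousLocalization.mapId (grading σ)
      (Q := η.asHomogeneousIdeal.toIdeal.primeCompl) (Submonoid.powers_le.mpr hk)
        (dehomogenize k f)) ↔ f ∉ η.asHomogeneousIdeal := by
  have hf' : f ∈ grading σ (d • 1) := by simpa using hf
  rw [dehomogenize_eq_mk k hf', HomogeneousLocalization.Away.mk,
    ← HomogeneousLocalization.isUnit_iff_isUnit_val]
  refine (Iff.of_eq (congrArg (fun z => IsUnit (HomogeneousLocalization.val z))
    (HomogeneousLocalization.map_mk _ _ _))).trans ?_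
  rw [HomogeneousLocalization.val_mk, Localization.mk_eq_mk']
  exact IsLocalization.AtPrime.isUnit_mk'_iff _ _ _ _

lemma mem_basicOpen_awayToSection {k : σ} (η : space σ)
    (hk : (X k : MvPolynomial σ ℂ) ∉ η.asHomogeneousIdeal) {d : ℕ} {f : MvPolynomial σ ℂ}
    (hf : f ∈ grading σ d) :
    η ∈ (space σ).basicOpen ((Proj.awayToSection (grading σ) (X k)).hom (dehomogenize k f)) ↔
      f ∉ η.asHomogeneousIdeal := by
  have hη : η ∈ Proj.basicOpen (grading σ) (X k) := hk
  rw [Scheme.mem_basicOpen _ _ _ hη]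
  have h := ProjectiveSpectrum.Proj.awayToSection_germ (grading σ) (X k) η hη
  have h2 := congrArg (fun g => g.hom (dehomogenize k f)) h
  have h3 : ((space σ).presheaf.germ _ η hη).hom
      ((Proj.awayToSection (grading σ) (X k)).hom (dehomogenize k f)) =
      (Proj.stalkIso' (grading σ) η).toCommRingCatIso.inv.hom
        (HomogeneousLocalization.mapId (grading σ) (Submonoid.powers_le.mpr hk)
          (dehomogenize k f)) := h2
  have h4 : ∀ z, IsUnit ((Proj.stalkIso' (grading σ) η).toCommRingCatIso.inv.hom z) ↔ IsUnit z :=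
    fun z => isUnit_map_iff (Proj.stalkIso' (grading σ) η).symm z
  refine (Iff.of_eq (congrArg IsUnit h3)).trans ((h4 _).trans ?_)
  exact isUnit_mapId_dehomogenize η hk hf

/-- A function on an affine open set vanishes on the closure of the point `η` if and only if it
vanishes at `η`, or `η` is not in the open set. -/
lemma mem_vanishingIdeal_closure_singleton {Y : Scheme} (η : Y) (U : Y.affineOpens)
    (s : Γ(Y, U)) :
    s ∈ (Scheme.IdealSheafData.vanishingIdeal (Closeds.closure {η})).ideal U ↔
      η ∉ Y.basicOpen s := by
  rw [Scheme.IdealSheafData.vanishingIdeal_ideal, PrimeSpectrum.mem_vanishingIdeal]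
  have key : ∀ p : PrimeSpectrum Γ(Y, U), s ∈ p.asIdeal ↔ U.2.fromSpec p ∉ Y.basicOpen s := by
    intro p
    have h : p ∈ U.2.fromSpec ⁻¹ᵁ Y.basicOpen s ↔ p ∈ PrimeSpectrum.basicOpen s := by
      rw [U.2.fromSpec_preimage_basicOpen]
      rfl
    rw [PrimeSpectrum.mem_basicOpen] at h
    rw [← not_iff_not, ← h, not_not]
    rfl
  constructor
  · intro h hη
    obtain ⟨p, hp⟩ : η ∈ Set.range U.2.fromSpec := by
      rw [U.2.range_fromSpec]
      exact Y.basicOpen_le s hη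
    refine (key p).mp (h p ?_) (hp ▸ hη)
    change U.2.fromSpec p ∈ closure {η}
    rw [hp]
    exact subset_closure rfl
  · intro hη p hp
    rw [key]
    intro hp'
    obtain ⟨x, hx, rfl⟩ := mem_closure_iff.mp hp _ (Y.basicOpen s).isOpen hp'
    exact hη hx

/-- The closure of the homogeneous prime `η` is cut out by homogeneous elements `s` of `η` if
the ideal of `s` and the prime `η` agree on each chart. The factor `X k` in the hypothesis serves
the charts that do not contain `η`, where the ideal of the closure is the unit ideal. -/
lemma isCutOutBy_closure_singleton (η : space σ) {s : Set (MvPolynomial σ ℂ)}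
    (hs : ∀ f ∈ s, ∃ d, f ∈ grading σ d) (hsη : ∀ f ∈ s, f ∈ η.asHomogeneousIdeal)
    (h : ∀ k d, ∀ f ∈ grading σ d, X k * f ∈ η.asHomogeneousIdeal →
      dehomogenize k f ∈ dehomogenized s k) :
    IsCutOutBy (Scheme.IdealSheafData.vanishingIdeal (Closeds.closure {η})) s := by
  intro k
  have hbij : Function.Bijective (Proj.awayToSection (grading σ) (X k)).hom :=
    ConcreteCategory.bijective_of_isIso
      (Proj.basicOpenIsoAway (grading σ) (X k) (X_mem σ k) one_pos).hom
  have key : ∀ d, ∀ f ∈ grading σ d,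
      (Proj.awayToSection (grading σ) (X k)).hom (dehomogenize k f) ∈
        (Scheme.IdealSheafData.vanishingIdeal (Closeds.closure {η})).ideal (chart σ k) ↔
      X k * f ∈ η.asHomogeneousIdeal := by
    intro d f hf
    refine (mem_vanishingIdeal_closure_singleton η (chart σ k) _).trans ?_
    by_cases hk : (X k : MvPolynomial σ ℂ) ∈ η.asHomogeneousIdeal
    · refine iff_of_true (fun h => ?_) (Ideal.mul_mem_right _ _ hk)
      exact (Scheme.basicOpen_le _ _ h : η ∈ Proj.basicOpen (grading σ) (X k)) hk
    · refine (not_congr (mem_basicOpen_awayToSection η hk hf)).trans ?_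
      rw [not_not]
      exact ⟨fun hf => Ideal.mul_mem_left _ _ hf, fun h => (η.isPrime.mem_or_mem h).resolve_left hk⟩
  apply le_antisymm
  · intro a ha
    obtain ⟨b, rfl⟩ := hbij.2 a
    obtain ⟨d, f, hf, rfl⟩ := exists_dehomogenize_eq k b
    exact Ideal.mem_map_of_mem _ (h k d f hf ((key d f hf).mp ha))
  · refine Ideal.map_le_iff_le_comap.mpr ?_
    rw [dehomogenized_eq_map hs, Ideal.map_span, Ideal.span_le]
    rintro _ ⟨f, hf, rfl⟩
    obtain ⟨d, hd⟩ := hs f hf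
    exact (key d f hd).mpr (Ideal.mul_mem_left _ _ (hsη f hf))

end ProjSp

namespace ProjSp

/-- The point of projective space whose homogeneous prime is generated by the homogeneous elements
of the kernel of a homomorphism to a domain, i.e. the image of the generic point of a
parametrization. -/
def kerPoint {σ A : Type} [CommRing A] [IsDomain A] [Algebra ℂ A] (φ : MvPolynomial σ ℂ →ₐ[ℂ] A)
    (k : σ) (hk : φ (X k) ≠ 0) : ProjectiveSpectrum (grading σ) where
  asHomogeneousIdeal := (RingHom.ker φ).homogeneousCore (grading σ)
  isPrime := (RingHom.ker_isPrime φ).homogeneousCore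
  not_irrelevant_le := fun h =>
    hk (Ideal.toIdeal_homogeneousCore_le (grading σ) _ (h (X_mem_irrelevant σ k)))

lemma mem_kerPoint {σ A : Type} [CommRing A] [IsDomain A] [Algebra ℂ A]
    (φ : MvPolynomial σ ℂ →ₐ[ℂ] A) (k : σ) (hk : φ (X k) ≠ 0) {d : ℕ} {f : MvPolynomial σ ℂ}
    (hf : f ∈ grading σ d) : f ∈ (kerPoint φ k hk).asHomogeneousIdeal ↔ φ f = 0 :=
  ⟨fun h => Ideal.toIdeal_homogeneousCore_le (grading σ) _ h,
   fun h => Ideal.mem_homogeneousCore_of_homogeneous_of_mem ⟨d, hf⟩ h⟩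

end ProjSp

namespace HalfAnti

open ProjSp Scrolls Coord

/-! ### The homogeneous ideal of `Q` -/

/-- The generic point of `Q`. -/
def genericQ : ProjectiveSpectrum (grading Coord) :=
  kerPoint torusMap y0012 (by simp [torusMap, idx])

lemma mem_genericQ {d : ℕ} {f : MvPolynomial Coord ℂ} (hf : f ∈ grading Coord d) :
    f ∈ genericQ.asHomogeneousIdeal ↔ torusMap f = 0 :=
  mem_kerPoint _ _ _ hf

lemma torusMap_X_ne_zero (l : Coord) : torusMap (X l) ≠ 0 := by
  simp [torusMap]

lemma eval_coxMap (p : CoxPoint 4) (f : MvPolynomial Coord ℂ) :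
    eval (coxMap p) f = eval (Sum.elim p.t p.x) (torusMap f) := by
  have h : (aeval (coxMap p) : MvPolynomial Coord ℂ →ₐ[ℂ] ℂ) =
      (aeval (Sum.elim p.t p.x)).comp torusMap := by
    apply MvPolynomial.algHom_ext
    intro l
    simp [torusMap, coxMap]
  exact DFunLike.congr_fun h f

lemma notMem_indeterminacy {p : CoxPoint 4} (hp : coxMap p ≠ 0) :
    Quotient.mk (orbitSetoid twists) p ∉ indeterminacy := by
  rintro ⟨q, hq, hq0⟩
  obtain ⟨l, m, ht, hx⟩ := Quotient.exact hq
  exact hp (by rw [coxMap_smul ht hx, hq0, smul_zero])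

/-- A relation that holds at the points outside the indeterminacy locus, for example on the torus,
is a polynomial identity. -/
lemma torusMap_eq_zero_of_eval {f : MvPolynomial Coord ℂ}
    (h : ∀ p : CoxPoint 4, coxMap p ≠ 0 → eval (coxMap p) f = 0) : torusMap f = 0 := by
  -- the factor removes the points outside the torus
  have h1 : torusMap f * ∏ v, X v = 0 := by
    apply MvPolynomial.funext
    intro z
    rw [map_mul, map_prod, map_zero]
    by_cases hz : ∀ v, z v ≠ 0
    · let p : CoxPoint 4 := ⟨fun i => z (.inl i), fun j => z (.inr j),
        fun h => hz (.inl 0) (congrFun h 0), fun h => hz (.inr 0) (congrFun h 0)⟩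
      have hp : coxMap p ≠ 0 := fun h0 => by
        have := congrFun h0 y0012
        simp [coxMap, idx, p, hz] at this
      have h2 := h p hp
      rw [eval_coxMap] at h2
      have h3 : Sum.elim p.t p.x = z := by
        funext v
        rcases v with v | v <;> rfl
      rw [← h3, h2, zero_mul]
    · push Not at hz
      obtain ⟨v, hv⟩ := hz
      rw [Finset.prod_eq_zero (Finset.mem_univ v) (by simpa using hv), mul_zero]
  refine (mul_eq_zero.mp h1).resolve_right (Finset.prod_ne_zero_iff.mpr fun v _ => X_ne_zero v)

lemma vanishingIdeal_range_phi0 :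
    ProjectiveSpectrum.vanishingIdeal (𝒜 := grading Coord) (Set.range phi0) =
      genericQ.asHomogeneousIdeal := by
  refine HomogeneousIdeal.ext' (𝒜 := grading Coord) fun d f hf => ?_
  rw [mem_genericQ hf]
  refine (ProjectiveSpectrum.mem_vanishingIdeal _ _).trans ⟨fun h => ?_, ?_⟩
  · refine torusMap_eq_zero_of_eval fun p hp => ?_
    have h1 := h _ ⟨⟨_, notMem_indeterminacy hp⟩, rfl⟩
    rw [phi0_mk p hp] at h1
    exact (homogeneous_mem_point_iff _ hf).mp h1
  · rintro h _ ⟨P, rfl⟩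
    refine (homogeneous_mem_point_iff _ hf).mpr ?_
    rw [eval_coxMap, h, map_zero]

lemma Q_eq_closure : Q = Closeds.closure {(genericQ : space Coord)} := by
  apply Closeds.ext
  change closure (Set.range phi0) = closure {(genericQ : space Coord)}
  have h1 := ProjectiveSpectrum.zeroLocus_vanishingIdeal_eq_closure (𝒜 := grading Coord)
    (Set.range phi0)
  have h2 := ProjectiveSpectrum.zeroLocus_vanishingIdeal_eq_closure (𝒜 := grading Coord)
    {genericQ}
  rw [ProjectiveSpectrum.vanishingIdeal_singleton, ← vanishingIdeal_range_phi0] at h2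
  exact h1.symm.trans h2

lemma homogeneousIdeal_Q : homogeneousIdeal Q = genericQ.asHomogeneousIdeal.toIdeal := by
  rw [← vanishingIdeal_range_phi0]
  exact congrArg HomogeneousIdeal.toIdeal
    (ProjectiveSpectrum.vanishingIdeal_closure (grading Coord) (Set.range phi0))

lemma minor_eq (i i' : Fin 4) (j j' : Fin 8) : (M0.submatrix ![i, i'] ![j, j']).det =
    X (M0idx i j) * X (M0idx i' j') - X (M0idx i j') * X (M0idx i' j) := by
  rw [Matrix.det_fin_two]
  simp [M0]

lemma minor_mem_grading (i i' : Fin 4) (j j' : Fin 8) :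
    (X (M0idx i j) * X (M0idx i' j') - X (M0idx i j') * X (M0idx i' j) : MvPolynomial Coord ℂ) ∈
      grading Coord 2 :=
  Submodule.sub_mem _ ((isHomogeneous_X ℂ _).mul (isHomogeneous_X ℂ _))
    ((isHomogeneous_X ℂ _).mul (isHomogeneous_X ℂ _))

/-- The labels of the rows of `M₀`, in the Cox ring. -/
def rowLabel : Fin 4 → MvPolynomial (CoxVar 4) ℂ :=
  ![X (.inr 1), X (.inr 2), X (.inl 0) * X (.inr 3), X (.inl 1) * X (.inr 3)]

/-- The labels of the columns of `M₀`, in the Cox ring. -/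
def colLabel : Fin 8 → MvPolynomial (CoxVar 4) ℂ :=
  ![X (.inr 0), X (.inl 0) * X (.inr 1), X (.inl 0) * X (.inr 2), X (.inl 1) * X (.inr 1),
    X (.inl 1) * X (.inr 2), X (.inl 0) ^ 2 * X (.inr 3), X (.inl 0) * X (.inl 1) * X (.inr 3),
    X (.inl 1) ^ 2 * X (.inr 3)]

/-- The pull-back of `M₀` to the Cox ring has rank one. -/
lemma torusMap_M0idx (i : Fin 4) (j : Fin 8) :
    torusMap (X (M0idx i j)) = rowLabel i * colLabel j := by
  fin_cases i <;> fin_cases j <;>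
    simp [M0idx, torusMap, idx, rowLabel, colLabel] <;> ring

lemma torusMap_minor (i i' : Fin 4) (j j' : Fin 8) :
    torusMap (X (M0idx i j) * X (M0idx i' j') - X (M0idx i j') * X (M0idx i' j)) = 0 := by
  simp only [map_sub, map_mul, torusMap_M0idx]
  ring

/-- The minors for unordered pairs of rows and columns are in the span of those in `minors2`. -/
lemma minor_mem_span (i i' : Fin 4) (j j' : Fin 8) :
    (X (M0idx i j) * X (M0idx i' j') - X (M0idx i j') * X (M0idx i' j) : MvPolynomial Coord ℂ) ∈
      Ideal.span (minors2 M0) := by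
  have key : ∀ i i' : Fin 4, ∀ j j' : Fin 8, i < i' → j < j' →
      (X (M0idx i j) * X (M0idx i' j') - X (M0idx i j') * X (M0idx i' j) :
        MvPolynomial Coord ℂ) ∈ Ideal.span (minors2 M0) := fun i i' j j' hi hj =>
    Ideal.subset_span ⟨i, i', j, j', hi, hj, (minor_eq i i' j j').symm⟩
  rcases lt_trichotomy i i' with hi | rfl | hi
  · rcases lt_trichotomy j j' with hj | rfl | hj
    · exact key _ _ _ _ hi hj
    · rw [sub_self]; exact zero_mem _
    · rw [← neg_sub]; exact neg_mem (key _ _ _ _ hi hj)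
  · rw [mul_comm, sub_self]; exact zero_mem _
  · rcases lt_trichotomy j j' with hj | rfl | hj
    · rw [← neg_sub, mul_comm (X (M0idx i j')), mul_comm (X (M0idx i j))]
      exact neg_mem (key _ _ _ _ hi hj)
    · rw [sub_self]; exact zero_mem _
    · rw [mul_comm (X (M0idx i j)), mul_comm (X (M0idx i j'))]; exact key _ _ _ _ hi hj

/-- On the chart `y_k ≠ 0`, the coordinates modulo the minors satisfy the hypotheses of
`aeval_eq_zero_of_rank_one`, so that all of `I(Q)` is zero modulo the minors. -/
theorem isCutOutBy_minors :
    IsCutOutBy (Scheme.IdealSheafData.vanishingIdeal Q) (minors2 M0) := by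
  rw [Q_eq_closure]
  have hs : ∀ f ∈ minors2 M0, ∃ d, f ∈ grading Coord d := by
    rintro _ ⟨i, i', j, j', -, -, rfl⟩
    exact ⟨2, minor_eq i i' j j' ▸ minor_mem_grading i i' j j'⟩
  refine isCutOutBy_closure_singleton _ hs ?_ ?_
  · rintro _ ⟨i, i', j, j', -, -, rfl⟩
    rw [minor_eq]
    exact (mem_genericQ (minor_mem_grading i i' j j')).mpr (torusMap_minor i i' j j')
  · intro k d f hf hk
    have h0 : torusMap f = 0 := by
      have h1 := (mem_genericQ ((isHomogeneous_X ℂ k).mul hf)).mp hk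
      rw [map_mul] at h1
      exact (mul_eq_zero.mp h1).resolve_left (torusMap_X_ne_zero k)
    let π := (Ideal.Quotient.mkₐ ℂ (dehomogenized (minors2 M0) k)).comp (dehomogenize k)
    have hπ : ∀ g, π g = 0 ↔ dehomogenize k g ∈ dehomogenized (minors2 M0) k := fun g =>
      Ideal.Quotient.eq_zero_iff_mem
    rw [← hπ]
    have h2 : aeval (fun l => π (X l)) = π := (MvPolynomial.aeval_unique π).symm
    rw [← h2]
    refine aeval_eq_zero_of_rank_one _ (fun i i' j j' => ?_) k ?_ hf h0
    · rw [← sub_eq_zero, ← map_mul, ← map_mul, ← map_sub, hπ, dehomogenized_eq_map hs]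
      exact Ideal.mem_map_of_mem _ (minor_mem_span i i' j j')
    · have : π (X k) = 1 := by
        simp only [π, AlgHom.comp_apply, dehomogenize_X_self, map_one]
      rw [this]
      exact isUnit_one

/-! ### The divisor `D` -/

lemma coordProj_firstColumn_X_zero : coordProj firstColumn (X (M0idx 0 0)) = X 0 :=
  coordProj_X firstColumn 0

/-- The generic point of `D`. -/
def genericD : ProjectiveSpectrum (grading Coord) :=
  kerPoint (coordProj firstColumn) (M0idx 0 0)
    (by rw [coordProj_firstColumn_X_zero]; exact X_ne_zero _)

lemma mem_genericD {d : ℕ} {f : MvPolynomial Coord ℂ} (hf : f ∈ grading Coord d) :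
    f ∈ genericD.asHomogeneousIdeal ↔ coordProj firstColumn f = 0 :=
  mem_kerPoint _ _ _ hf

lemma ker_coordProj : RingHom.ker (coordProj firstColumn) = Ideal.span otherVariables := by
  apply le_antisymm
  · intro f hf
    let π := Ideal.Quotient.mkₐ ℂ (Ideal.span otherVariables)
    have h : π = (π.comp (rename firstColumn)).comp (coordProj firstColumn) := by
      apply MvPolynomial.algHom_ext
      intro l
      simp only [AlgHom.comp_apply]
      by_cases hl : l ∈ Set.range firstColumn
      · obtain ⟨i, rfl⟩ := hl
        rw [coordProj_X, rename_X]
      · rw [coordProj, aeval_X, Function.extend_apply' _ _ _ hl, map_zero, map_zero]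
        exact Ideal.Quotient.eq_zero_iff_mem.mpr (Ideal.subset_span ⟨l, hl, rfl⟩)
    have h1 : π f = 0 := by
      rw [h, AlgHom.comp_apply, (RingHom.mem_ker).mp hf, map_zero]
    exact Ideal.Quotient.eq_zero_iff_mem.mp h1
  · rw [Ideal.span_le]
    rintro _ ⟨l, hl, rfl⟩
    change coordProj firstColumn (X l) = 0
    rw [coordProj, aeval_X, Function.extend_apply' _ _ _ hl]

lemma genericD_le : genericD.asHomogeneousIdeal.toIdeal ≤ Ideal.span otherVariables :=
  (Ideal.toIdeal_homogeneousCore_le (grading Coord) _).trans ker_coordProj.le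

lemma mem_genericD_of_mem_otherVariables {f : MvPolynomial Coord ℂ} (hf : f ∈ otherVariables) :
    f ∈ genericD.asHomogeneousIdeal := by
  have h : coordProj firstColumn f = 0 := (ker_coordProj.ge (Ideal.subset_span hf) :)
  obtain ⟨l, -, rfl⟩ := hf
  exact (mem_genericD (isHomogeneous_X ℂ l)).mpr h

lemma D_eq_closure : D = Closeds.closure {(genericD : space Coord)} := by
  apply Closeds.ext
  ext x
  have h1 : x ∈ Closeds.closure {(genericD : space Coord)} ↔
      genericD.asHomogeneousIdeal ≤ x.asHomogeneousIdeal :=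
    (ProjectiveSpectrum.le_iff_mem_closure (𝒜 := grading Coord) genericD x).symm
  refine Iff.trans ?_ h1.symm
  change otherVariables ⊆ x.asHomogeneousIdeal ↔ _
  constructor
  · intro h f hf
    exact Ideal.span_le.mpr h (genericD_le hf)
  · intro h f hf
    exact h (mem_genericD_of_mem_otherVariables hf)

theorem isCutOutBy_otherVariables :
    IsCutOutBy (Scheme.IdealSheafData.vanishingIdeal D) otherVariables := by
  rw [D_eq_closure]
  have hs : ∀ f ∈ otherVariables, ∃ d, f ∈ grading Coord d := by
    rintro _ ⟨l, -, rfl⟩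
    exact ⟨1, isHomogeneous_X ℂ l⟩
  refine isCutOutBy_closure_singleton _ hs (fun f hf => mem_genericD_of_mem_otherVariables hf) ?_
  intro k d f hf hk
  have h := Ideal.mem_map_of_mem (dehomogenize k) (genericD_le hk)
  rwa [← dehomogenized_eq_map hs, map_mul, dehomogenize_X_self, one_mul] at h

end HalfAnti

namespace ProjSp

/-! ### Coordinate linear embeddings are closed immersions -/

lemma coordProj_rename {τ σ : Type} (e : τ ↪ σ) (f : MvPolynomial τ ℂ) :
    coordProj e (rename e f) = f := by
  have h : (coordProj e).comp (rename e) = AlgHom.id ℂ _ := by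
    apply MvPolynomial.algHom_ext
    intro j
    simp [coordProj_X]
  exact DFunLike.congr_fun h f

lemma away_map_coordProj_surjective {τ σ : Type} (e : τ ↪ σ) (k : σ) :
    Function.Surjective (HomogeneousLocalization.Away.map (coordProjGraded e) (X k)) := by
  intro a
  obtain ⟨d, f, hf, rfl⟩ := HomogeneousLocalization.Away.mk_surjective (grading τ)
    (coordProj_mem e (X_mem σ k)) a
  have hf' : rename e f ∈ grading σ (d • 1) := IsHomogeneous.rename_isHomogeneous hf
  refine ⟨HomogeneousLocalization.Away.mk (grading σ) (X_mem σ k) d (rename e f) hf', ?_⟩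
  rw [HomogeneousLocalization.Away.map_mk]
  congr 1
  exact coordProj_rename e f

lemma iSup_chart (σ : Type) : ⨆ k : σ, (chart σ k : (space σ).Opens) = ⊤ := by
  refine Proj.iSup_basicOpen_eq_top (grading σ) (fun k => X k) ?_
  refine (HomogeneousIdeal.toIdeal_irrelevant_le (𝒜 := grading σ)).mpr fun d hd f hf => ?_
  change f ∈ Ideal.span (Set.range X)
  rw [← Set.image_univ, MvPolynomial.mem_ideal_span_X_image]
  intro u hu
  by_contra! h
  have h0 : u = 0 := Finsupp.ext fun i => h i (Set.mem_univ i)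
  have h1 := IsHomogeneous.degree_eq_sum_deg_support hf hu
  simp only [h0, Finsupp.support_zero, Finset.sum_empty] at h1
  exact hd.ne' h1

/-- The global sections of `f ∣_ U` are those of `f` on `U`, up to isomorphisms. -/
lemma morphismRestrict_appTop_surjective {Y Z : Scheme} (f : Y ⟶ Z) (U : Z.Opens)
    (hf : Function.Surjective (f.app U)) : Function.Surjective (f ∣_ U).appTop := by
  have h : ∀ V, V = U → Function.Surjective (f.app V) := by
    rintro _ rfl
    exact hf
  rw [morphismRestrict_appTop]
  intro c
  obtain ⟨b, rfl⟩ := (ConcreteCategory.bijective_of_isIso (Y.presheaf.map (eqToHom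
    (image_morphismRestrict_preimage f U ⊤)).op)).2 c
  obtain ⟨a, rfl⟩ := h _ (Scheme.Opens.ι_image_top U) b
  exact ⟨a, rfl⟩

theorem isClosedImmersion_linearEmbedding {τ σ : Type} (e : τ ↪ σ) :
    IsClosedImmersion (linearEmbedding e) := by
  have hP := IsClosedImmersion.hasAffineProperty
  refine (hP.iff_of_iSup_eq_top (chart σ) (iSup_chart σ)).mpr ?_
  intro k
  have hk : coordProj e (X k) ∈ grading τ 1 := coordProj_mem e (X_mem σ k)
  have haff : IsAffineOpen (linearEmbedding e ⁻¹ᵁ Proj.basicOpen (grading σ) (X k)) :=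
    Proj.isAffineOpen_basicOpen (grading τ) (coordProj e (X k)) hk one_pos
  refine ⟨haff, ?_⟩
  apply morphismRestrict_appTop_surjective
  have h2 := Proj.awayToSection_comp_appLE (coordProjGraded e) (irrelevant_le e) (X_mem σ k)
  have h3 : Function.Surjective (Proj.awayToSection (grading τ) (coordProj e (X k))).hom :=
    (ConcreteCategory.bijective_of_isIso
      (Proj.basicOpenIsoAway (grading τ) (coordProj e (X k)) hk one_pos).hom).2
  intro a
  obtain ⟨b, hb⟩ := h3 a
  obtain ⟨c, rfl⟩ := away_map_coordProj_surjective e k b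
  refine ⟨Proj.awayToSection (grading σ) (X k) c, ?_⟩
  have h4 := congrArg (fun g => g.hom c) h2
  refine Eq.trans ?_ (h4.trans hb)
  rw [← Scheme.Hom.appLE_eq_app]
  rfl

lemma isReduced_atPrime {σ : Type} (η : ProjectiveSpectrum (grading σ)) :
    _root_.IsReduced
      (HomogeneousLocalization.AtPrime (grading σ) η.asHomogeneousIdeal.toIdeal) := by
  have : IsDomain (Localization.AtPrime η.asHomogeneousIdeal.toIdeal) :=
    IsLocalization.isDomain_localization (Ideal.primeCompl_le_nonZeroDivisors _)
  exact isReduced_of_injective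
    (algebraMap (HomogeneousLocalization.AtPrime (grading σ) η.asHomogeneousIdeal.toIdeal)
      (Localization.AtPrime η.asHomogeneousIdeal.toIdeal))
    (HomogeneousLocalization.val_injective _)

instance isReduced_space (σ : Type) : AlgebraicGeometry.IsReduced (space σ) := by
  have : ∀ x : space σ, _root_.IsReduced ((space σ).presheaf.stalk x) := fun x => by
    have := isReduced_atPrime x
    exact isReduced_of_injective (Proj.stalkIso (grading σ) x).hom.hom
      (ConcreteCategory.bijective_of_isIso (Proj.stalkIso (grading σ) x).hom).1
  exact isReduced_of_isReduced_stalk _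

/-- As projective space is reduced, the scheme-theoretic image of a linear embedding is the closure
of its image with the reduced structure. -/
theorem ker_linearEmbedding {τ σ : Type} (e : τ ↪ σ) :
    (linearEmbedding e).ker = Scheme.IdealSheafData.vanishingIdeal
      (.closure (Set.range (linearEmbedding e))) := by
  rw [← Scheme.IdealSheafData.map_bot, ← Scheme.nilradical_eq_bot,
    ← Scheme.IdealSheafData.vanishingIdeal_top, Scheme.IdealSheafData.map_vanishingIdeal]
  congr 2
  exact Set.image_univ

end ProjSp

namespace HalfAnti

open ProjSp Scrolls Coord

lemma closure_range_linearEmbedding :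
    closure (Set.range (linearEmbedding firstColumn)) = closure {(genericD : space Coord)} := by
  let ξ : space (Fin 4) :=
    kerPoint (AlgHom.id ℂ (MvPolynomial (Fin 4) ℂ)) 0 (X_ne_zero 0)
  have hξ : ∀ x : space (Fin 4), x ∈ closure {ξ} := fun x => by
    refine (ProjectiveSpectrum.le_iff_mem_closure (𝒜 := grading (Fin 4)) ξ x).mp ?_
    intro f hf
    have h0 : f = 0 := Ideal.toIdeal_homogeneousCore_le (grading (Fin 4)) _ hf
    rw [h0]
    exact Ideal.zero_mem _
  have hgen : linearEmbedding firstColumn ξ = (genericD : space Coord) := by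
    apply ProjectiveSpectrum.ext
    refine HomogeneousIdeal.ext' (𝒜 := grading Coord) fun d f hf => ?_
    rw [mem_genericD hf]
    exact mem_kerPoint (AlgHom.id ℂ (MvPolynomial (Fin 4) ℂ)) 0 (X_ne_zero 0) (coordProj_mem _ hf)
  apply subset_antisymm
  · refine closure_minimal ?_ isClosed_closure
    rintro _ ⟨x, rfl⟩
    have h1 := image_closure_subset_closure_image (linearEmbedding firstColumn).continuous
      ⟨x, hξ x, rfl⟩
    have h2 : linearEmbedding firstColumn '' {ξ} = {(genericD : space Coord)} :=
      Set.image_singleton.trans (congrArg (fun y : space Coord => ({y} : Set (space Coord))) hgen)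
    exact h2 ▸ h1
  · refine closure_mono ?_
    rintro _ rfl
    exact ⟨ξ, hgen⟩

theorem ker_linearEmbedding_firstColumn :
    (linearEmbedding firstColumn).ker = Scheme.IdealSheafData.vanishingIdeal D := by
  rw [ker_linearEmbedding, D_eq_closure]
  congr 1
  exact Closeds.ext closure_range_linearEmbedding

/-! ### `D` is a prime divisor -/

lemma genericQ_le_genericD : genericQ.asHomogeneousIdeal ≤ genericD.asHomogeneousIdeal := by
  have h : ∀ d, ∀ f ∈ grading Coord d, f ∈ genericQ.asHomogeneousIdeal →
      f ∈ genericD.asHomogeneousIdeal := by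
    intro d f hf hfQ
    rw [mem_genericD hf]
    rw [mem_genericQ hf] at hfQ
    -- the divisor `D` is the locus `T = 0` of the parametrization
    have h1 := aeval_cone_eq_zero (B := MvPolynomial (Fin 4) ℂ) X 0 1 (by simp) hf hfQ
    have h2 : coordProj firstColumn = aeval (cone X 0 1) := by
      apply MvPolynomial.algHom_ext
      intro l
      rw [aeval_X]
      by_cases hl : l ∈ Set.range firstColumn
      · obtain ⟨i, rfl⟩ := hl
        rw [coordProj_X]
        exact ((cone_M0idx_zero X 0 1 i).trans (mul_one _)).symm
      · rw [coordProj, aeval_X, Function.extend_apply' _ _ _ hl]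
        rcases coord_cases l with ⟨i, rfl⟩ | ⟨k, i, i', rfl⟩
        · exact absurd ⟨i, rfl⟩ hl
        · rw [cone_M0idx_col _ _ _ (by simp)]
          simp
    rw [h2, h1]
  intro f hf
  rw [← DirectSum.sum_support_decompose (grading Coord) f]
  refine Ideal.sum_mem _ fun d _ => h d _ (SetLike.coe_mem _) ?_
  exact genericQ.asHomogeneousIdeal.isHomogeneous d hf

lemma col_ne_zero (k : Fin 2) (i : Fin 4) : col k i ≠ 0 := by
  revert k i; decide

lemma firstColumn_notMem {q : Ideal (MvPolynomial Coord ℂ)}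
    (hq : q ≤ genericD.asHomogeneousIdeal.toIdeal) (i : Fin 4) : X (M0idx i 0) ∉ q := by
  intro h
  have h1 : coordProj firstColumn (X (firstColumn i)) = 0 :=
    (mem_genericD (isHomogeneous_X ℂ _)).mp (hq h)
  rw [coordProj_X] at h1
  exact X_ne_zero i h1

/-- A prime between `I(Q)` and `I(D)` that contains `y₁₀₂₂` is `I(D)`: it contains no entry of the
first column, so by the minors with that column it contains all entries of a column as soon as it
contains one. Starting with `y₁₀₂₂`, this reaches all columns except the first. -/
lemma genericD_le_of_X_mem {q : Ideal (MvPolynomial Coord ℂ)} [q.IsPrime]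
    (hq : q ≤ genericD.asHomogeneousIdeal.toIdeal)
    (hQ : genericQ.asHomogeneousIdeal.toIdeal ≤ q) (hX : X (M0idx 0 1) ∈ q) :
    genericD.asHomogeneousIdeal.toIdeal ≤ q := by
  have hcol : ∀ i i' j, X (M0idx i j) ∈ q → X (M0idx i' j) ∈ q := by
    intro i i' j h
    have h1 := hQ ((mem_genericQ (minor_mem_grading i i' 0 j)).mpr (torusMap_minor i i' 0 j))
    have h2 : X (M0idx i 0) * X (M0idx i' j) ∈ q := by
      have := Ideal.add_mem _ h1 (Ideal.mul_mem_right (X (M0idx i' 0)) _ h)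
      rwa [sub_add_cancel] at this
    exact (Ideal.IsPrime.mem_or_mem ‹_› h2).resolve_left (firstColumn_notMem hq i)
  have h1 : ∀ i, X (M0idx i 1) ∈ q := fun i => hcol 0 i 1 hX
  have h2 : ∀ i, X (M0idx i 2) ∈ q := fun i => hcol 0 i 2 (h1 1)
  have h3 : ∀ i, X (M0idx i 3) ∈ q := fun i => hcol 2 i 3 (h1 3)
  have h4 : ∀ i, X (M0idx i 4) ∈ q := fun i => hcol 0 i 4 (h3 1)
  have h5 : ∀ i, X (M0idx i 5) ∈ q := fun i => hcol 0 i 5 (h1 2)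
  have h6 : ∀ i, X (M0idx i 6) ∈ q := fun i => hcol 0 i 6 (h1 3)
  have h7 : ∀ i, X (M0idx i 7) ∈ q := fun i => hcol 0 i 7 (h3 3)
  refine genericD_le.trans (Ideal.span_le.mpr ?_)
  rintro _ ⟨l, hl, rfl⟩
  rcases coord_cases l with ⟨i, rfl⟩ | ⟨k, i, i', rfl⟩
  · exact absurd ⟨i, rfl⟩ hl
  · generalize hj : col k i' = j
    have hj0 : j ≠ 0 := hj ▸ col_ne_zero k i'
    fin_cases j
    exacts [absurd rfl hj0, h1 i, h2 i, h3 i, h4 i, h5 i, h6 i, h7 i]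

instance finite_coord : Finite Coord :=
  Finite.of_surjective (fun ij : Fin 4 × Fin 8 => M0idx ij.1 ij.2) fun l => by
    rcases coord_cases l with ⟨i, h⟩ | ⟨k, i, i', h⟩
    exacts [⟨(i, 0), h.symm⟩, ⟨(i, _), h.symm⟩]

/-- The prime `I(D)` is minimal over `I(Q) + (y₁₀₂₂)`, so by Krull's principal ideal theorem `D`
has codimension at most one in `Q`. -/
lemma not_exists_prime_between (p : Ideal (MvPolynomial Coord ℂ)) [p.IsPrime]
    (h1 : genericQ.asHomogeneousIdeal.toIdeal < p)
    (h2 : p < genericD.asHomogeneousIdeal.toIdeal) : False := by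
  set I := genericQ.asHomogeneousIdeal.toIdeal with hI
  set J := genericD.asHomogeneousIdeal.toIdeal with hJ
  have hIp : I.IsPrime := genericQ.isPrime
  have hJp : J.IsPrime := genericD.isPrime
  have hmin : J ∈ (I ⊔ Ideal.span {X (M0idx 0 1)}).minimalPrimes := by
    refine ⟨⟨hJp, sup_le (h1.le.trans h2.le) ?_⟩, ?_⟩
    · rw [Ideal.span_singleton_le_iff_mem]
      exact mem_genericD_of_mem_otherVariables ⟨M0idx 0 1, by decide, rfl⟩
    · rintro q ⟨hq, hle⟩ hqJ
      exact genericD_le_of_X_mem hqJ (le_sup_left.trans hle)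
        (hle (Ideal.mem_sup_right (Ideal.mem_span_singleton_self _)))
  have hht := Ideal.map_height_le_one_of_mem_minimalPrimes hmin
  have hker : RingHom.ker (Ideal.Quotient.mk I) = I := Ideal.mk_ker
  have hp' : (p.map (Ideal.Quotient.mk I)).IsPrime :=
    Ideal.map_isPrime_of_surjective Ideal.Quotient.mk_surjective (hker.trans_le h1.le)
  have hJ' : (J.map (Ideal.Quotient.mk I)).IsPrime :=
    Ideal.map_isPrime_of_surjective Ideal.Quotient.mk_surjective
      (hker.trans_le (h1.le.trans h2.le))
  have hcomap : ∀ K : Ideal (MvPolynomial Coord ℂ), I ≤ K →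
      (K.map (Ideal.Quotient.mk I)).comap (Ideal.Quotient.mk I) = K := fun K hK => by
    rw [Ideal.comap_map_of_surjective _ Ideal.Quotient.mk_surjective]
    exact sup_eq_left.mpr (hker.trans_le hK)
  have hlt1 : (⊥ : Ideal (MvPolynomial Coord ℂ ⧸ I)) < p.map (Ideal.Quotient.mk I) := by
    rw [bot_lt_iff_ne_bot]
    intro h
    have := hcomap p h1.le
    rw [h] at this
    exact h1.ne (hker.symm.trans this)
  have hlt2 : p.map (Ideal.Quotient.mk I) < J.map (Ideal.Quotient.mk I) := by
    refine lt_of_le_of_ne (Ideal.map_mono h2.le) fun h => h2.ne ?_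
    rw [← hcomap p h1.le, h, hcomap J (h1.le.trans h2.le)]
  have e1 := Ideal.height_add_one_le_of_lt_of_isPrime hlt1
  have e2 := Ideal.height_add_one_le_of_lt_of_isPrime hlt2
  have e3 : (1 : ℕ∞) + 1 ≤ 1 :=
    (add_le_add_left (le_add_self.trans e1) 1).trans (e2.trans hht)
  exact absurd e3 (by decide)

theorem isPrimeDivisor_D : IsPrimeDivisor D Q := by
  have hD : IsIrreducible (D : Set (space Coord)) := by
    rw [D_eq_closure]
    exact isIrreducible_singleton.closure
  have hQ : IsIrreducible (Q : Set (space Coord)) := by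
    rw [Q_eq_closure]
    exact isIrreducible_singleton.closure
  have hmemQ : ∀ x : space Coord, x ∈ (Q : Set (space Coord)) ↔
      genericQ.asHomogeneousIdeal ≤ x.asHomogeneousIdeal := fun x => by
    rw [Q_eq_closure]
    exact (ProjectiveSpectrum.le_iff_mem_closure (𝒜 := grading Coord) genericQ x).symm
  have hmemD : ∀ x : space Coord, x ∈ (D : Set (space Coord)) ↔
      genericD.asHomogeneousIdeal ≤ x.asHomogeneousIdeal := fun x => by
    rw [D_eq_closure]
    exact (ProjectiveSpectrum.le_iff_mem_closure (𝒜 := grading Coord) genericD x).symm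
  refine ⟨hD, hQ, ?_, ?_⟩
  · rw [← SetLike.coe_ssubset_coe]
    refine ⟨fun x hx => (hmemQ x).mpr (genericQ_le_genericD.trans ((hmemD x).mp hx)), fun h => ?_⟩
    have h1 := (hmemD _).mp (h ((hmemQ genericQ).mpr le_rfl))
    have h2 : X (M0idx 0 1) ∈ genericQ.asHomogeneousIdeal :=
      h1 (mem_genericD_of_mem_otherVariables ⟨M0idx 0 1, by decide, rfl⟩)
    rw [mem_genericQ (isHomogeneous_X ℂ _)] at h2
    exact torusMap_X_ne_zero _ h2
  · intro Z h1 h2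
    rw [← SetLike.coe_ssubset_coe] at h1 h2
    let ζ := Z.isIrreducible'.genericPoint
    have hζ : closure {ζ} = (Z : Set (space Coord)) :=
      Z.isIrreducible'.isGenericPoint_genericPoint Z.isClosed'
    have hmemZ : ∀ x : space Coord, x ∈ (Z : Set (space Coord)) ↔
        ζ.asHomogeneousIdeal ≤ x.asHomogeneousIdeal := fun x => by
      rw [← hζ]
      exact (ProjectiveSpectrum.le_iff_mem_closure (𝒜 := grading Coord) ζ x).symm
    have : ζ.asHomogeneousIdeal.toIdeal.IsPrime := ζ.isPrime
    refine not_exists_prime_between ζ.asHomogeneousIdeal.toIdeal (lt_of_le_not_ge ?_ ?_)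
      (lt_of_le_not_ge ?_ ?_)
    · exact (hmemQ ζ).mp (h2.1 ((hmemZ ζ).mpr le_rfl))
    · exact fun h => h2.2 fun x hx => (hmemZ x).mpr (le_trans h ((hmemQ x).mp hx))
    · exact (hmemZ genericD).mp (h1.1 ((hmemD genericD).mpr le_rfl))
    · exact fun h => h1.2 fun x hx => (hmemD x).mpr (le_trans h ((hmemZ x).mp hx))

end HalfAnti

namespace Scrolls

/-! ### Čech cohomology of line bundles on scrolls -/

/-- The Čech differential for functions on tuples, i.e. for the component of the Čech complex of a
fixed Laurent monomial. Functions on the empty tuple provide the augmentation. -/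
def tupleDelta {ι K : Type} [Field K] {p : ℕ} (f : (Fin p → ι) → K) (s : Fin (p + 1) → ι) : K :=
  ∑ k : Fin (p + 1), (-1) ^ (k : ℕ) * f fun i => s (k.succAbove i)

section tuple

variable {ι K : Type} [Field K]

lemma tupleDelta_cons {p : ℕ} (f : (Fin (p + 1) → ι) → K) (v : ι) (s : Fin (p + 1) → ι) :
    tupleDelta f (Fin.cons v s : Fin (p + 2) → ι) =
      f s - tupleDelta (fun s' => f (Fin.cons v s' : Fin (p + 1) → ι)) s := by
  rw [tupleDelta, Fin.sum_univ_succ, tupleDelta, sub_eq_add_neg, ← Finset.sum_neg_distrib]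
  congr 1
  · simp
  · refine Finset.sum_congr rfl fun k _ => ?_
    have h : (fun i => (Fin.cons v s : Fin (p + 2) → ι) (k.succ.succAbove i)) =
        (Fin.cons v fun i => s (k.succAbove i) : Fin (p + 1) → ι) := by
      funext i
      refine Fin.cases ?_ (fun i => ?_) i <;> simp
    rw [h, Fin.val_succ, pow_succ]
    ring

lemma tupleDelta_sub {p : ℕ} (f g : (Fin p → ι) → K) :
    tupleDelta (f - g) = tupleDelta f - tupleDelta g := by
  funext s
  simp [tupleDelta, mul_sub]

lemma tupleDelta_tupleDelta {p : ℕ} (f : (Fin p → ι) → K) : tupleDelta (tupleDelta f) = 0 := by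
  induction p with
  | zero =>
    funext s
    have h : ∀ a b : Fin 0 → ι, f a = f b := fun a b => congrArg f (Subsingleton.elim a b)
    simp only [tupleDelta, Fin.sum_univ_succ]
    simp [h _ Fin.elim0]
  | succ p ih =>
    funext s
    rw [← Fin.cons_self_tail s, tupleDelta_cons]
    have h : (fun s' => tupleDelta f (Fin.cons (s 0) s' : Fin (p + 2) → ι)) =
        f - tupleDelta (fun s' => f (Fin.cons (s 0) s' : Fin (p + 1) → ι)) :=
      funext fun s' => tupleDelta_cons f (s 0) s'
    rw [h, tupleDelta_sub, ih]
    simp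

lemma tupleDelta_cons_eq {p : ℕ} {f : (Fin (p + 1) → ι) → K} (hf : tupleDelta f = 0) (v : ι) :
    tupleDelta (fun s => f (Fin.cons v s : Fin (p + 1) → ι)) = f := by
  funext s
  have h := tupleDelta_cons f v s
  rw [hf, Pi.zero_apply, eq_comm, sub_eq_zero] at h
  exact h.symm

lemma exists_ne_zero_of_tupleDelta_ne_zero {p : ℕ} {f : (Fin p → ι) → K} {s : Fin (p + 1) → ι}
    (h : tupleDelta f s ≠ 0) : ∃ k : Fin (p + 1), f (fun i => s (k.succAbove i)) ≠ 0 := by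
  by_contra! h'
  exact h (Finset.sum_eq_zero fun k _ => by rw [h' k, mul_zero])

end tuple

section pointwise

variable {K : Type} [Field K] {n : ℕ}

/-- The Laurent monomial with exponents `u` is regular on the intersection of the charts in `s`. -/
def RegularOn {p : ℕ} (u : CoxVar n → ℤ) (s : Fin p → ChartIdx n) : Prop :=
  ∀ v, u v < 0 → InvertibleOn s v

lemma regularOn_inl_of_cons {p : ℕ} {u : CoxVar n → ℤ} {s : Fin p → ChartIdx n} {i i' : Fin 2}
    {j : Fin n} (hi' : i' ≠ i) (hu : u (.inl i') < 0)
    (h : RegularOn u (Fin.cons (i, j) s : Fin (p + 1) → ChartIdx n)) : ∃ k, (s k).1 = i' := by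
  obtain ⟨k, hk⟩ := h (.inl i') hu
  revert hk
  refine Fin.cases ?_ (fun k hk => ?_) k
  · exact fun hk => absurd hk.symm hi'
  · exact ⟨k, by simpa using hk⟩

lemma regularOn_inr_of_cons {p : ℕ} {u : CoxVar n → ℤ} {s : Fin p → ChartIdx n} {i : Fin 2}
    {j j' : Fin n} (hj : 0 ≤ u (.inr j)) (hu : u (.inr j') < 0)
    (h : RegularOn u (Fin.cons (i, j) s : Fin (p + 1) → ChartIdx n)) : ∃ k, (s k).2 = j' := by
  obtain ⟨k, hk⟩ := h (.inr j') hu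
  revert hk
  refine Fin.cases ?_ (fun k hk => ?_) k
  · rintro rfl
    exact absurd hu (not_lt.mpr hj)
  · exact ⟨k, by simpa using hk⟩

/-- If neither all `t`-exponents nor all `x`-exponents of `u` are negative, then there is a chart
where `u` is regular; it gives a contracting homotopy. -/
lemma exists_primitive_of_nonneg {p : ℕ} {u : CoxVar n → ℤ} {i : Fin 2} {j : Fin n}
    (hi : 0 ≤ u (.inl i)) (hj : 0 ≤ u (.inr j)) {f : (Fin (p + 1) → ChartIdx n) → K}
    (hf : ∀ s, f s ≠ 0 → RegularOn u s) (hδ : tupleDelta f = 0) :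
    ∃ b : (Fin p → ChartIdx n) → K, (∀ s, b s ≠ 0 → RegularOn u s) ∧ tupleDelta b = f := by
  refine ⟨fun s => f (Fin.cons (i, j) s), fun s hs => ?_, tupleDelta_cons_eq hδ _⟩
  have h := hf _ hs
  rintro (v | v) hv
  · exact regularOn_inl_of_cons (fun e => absurd hv (not_lt.mpr (e ▸ hi))) hv h
  · exact regularOn_inr_of_cons hj hv h

/-- Prepending a chart `(i, j)` with nonnegative `x_j`-exponent keeps the conditions on the
`x`-exponents, and the condition on the `t`-exponent with index `i' ≠ i`. -/
lemma exists_eq_of_cons_ne_zero {p : ℕ} {u : CoxVar n → ℤ} {j : Fin n} (ht : ∀ i, u (.inl i) < 0)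
    (hj : 0 ≤ u (.inr j)) {f : (Fin (p + 1) → ChartIdx n) → K}
    (hf : ∀ s, f s ≠ 0 → RegularOn u s) {i i' : Fin 2} (hi : i' ≠ i) {s : Fin p → ChartIdx n}
    (hs : f (Fin.cons (i, j) s) ≠ 0) :
    (∃ k, (s k).1 = i') ∧ ∀ v, u (.inr v) < 0 → ∃ k, (s k).2 = v :=
  ⟨regularOn_inl_of_cons hi (ht i') (hf _ hs), fun _ hv => regularOn_inr_of_cons hj hv (hf _ hs)⟩

/-- If both `t`-exponents of `u` are negative, then the primitives `b₀`, `b₁` from the charts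
`(0, j)` and `(1, j)` each satisfy only one of the two conditions on the `t`-exponents. As in the
Mayer–Vietoris sequence, their difference is `δ e`, and `e` splits into two parts that satisfy one
condition each; moving them to the two sides of `b₀ - b₁ = δ e` gives a primitive that satisfies
both. -/
lemma exists_primitive_of_neg {p : ℕ} {u : CoxVar n → ℤ} {j : Fin n} (ht : ∀ i, u (.inl i) < 0)
    (hj : 0 ≤ u (.inr j)) {f : (Fin (p + 3) → ChartIdx n) → K}
    (hf : ∀ s, f s ≠ 0 → RegularOn u s) (hδ : tupleDelta f = 0) :
    ∃ b : (Fin (p + 2) → ChartIdx n) → K, (∀ s, b s ≠ 0 → RegularOn u s) ∧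
      tupleDelta b = f := by
  classical
  let b₀ : (Fin (p + 2) → ChartIdx n) → K := fun s => f (Fin.cons (0, j) s)
  let b₁ : (Fin (p + 2) → ChartIdx n) → K := fun s => f (Fin.cons (1, j) s)
  have hb₀ : tupleDelta b₀ = f := tupleDelta_cons_eq hδ _
  have hb₁ : tupleDelta b₁ = f := tupleDelta_cons_eq hδ _
  have hs₀ : ∀ s, b₀ s ≠ 0 → (∃ k, (s k).1 = 1) ∧ ∀ v, u (.inr v) < 0 → ∃ k, (s k).2 = v :=
    fun s => exists_eq_of_cons_ne_zero ht hj hf one_ne_zero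
  have hs₁ : ∀ s, b₁ s ≠ 0 → (∃ k, (s k).1 = 0) ∧ ∀ v, u (.inr v) < 0 → ∃ k, (s k).2 = v :=
    fun s => exists_eq_of_cons_ne_zero ht hj hf zero_ne_one
  let e : (Fin (p + 1) → ChartIdx n) → K := fun s => (b₀ - b₁) (Fin.cons (0, j) s)
  have he : tupleDelta e = b₀ - b₁ :=
    tupleDelta_cons_eq (by rw [tupleDelta_sub, hb₀, hb₁, sub_self]) _
  have hse : ∀ s, e s ≠ 0 → ∀ v, u (.inr v) < 0 → ∃ k, (s k).2 = v := by
    intro s hs v hv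
    have h : ∃ k, ((Fin.cons (0, j) s : Fin (p + 2) → ChartIdx n) k).2 = v := by
      by_cases h0 : b₀ (Fin.cons (0, j) s) = 0
      · refine (hs₁ (Fin.cons (0, j) s) fun h1 => hs ?_).2 v hv
        simp only [e, Pi.sub_apply, h0, h1, sub_zero]
      · exact (hs₀ _ h0).2 v hv
    obtain ⟨k, hk⟩ := h
    revert hk
    refine Fin.cases ?_ (fun k hk => ?_) k
    · rintro rfl
      exact absurd hv (not_lt.mpr hj)
    · exact ⟨k, by simpa using hk⟩
  let e₁ : (Fin (p + 1) → ChartIdx n) → K := fun s => if ∃ k, (s k).1 = 1 then e s else 0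
  have hface : ∀ g : (Fin (p + 1) → ChartIdx n) → K, ∀ i : Fin 2,
      (∀ s, g s ≠ 0 → (∃ k, (s k).1 = i) ∧ ∀ v, u (.inr v) < 0 → ∃ k, (s k).2 = v) →
      ∀ s, tupleDelta g s ≠ 0 →
        (∃ k, (s k).1 = i) ∧ ∀ v, u (.inr v) < 0 → ∃ k, (s k).2 = v := by
    intro g i hg s hs
    obtain ⟨k, hk⟩ := exists_ne_zero_of_tupleDelta_ne_zero hs
    obtain ⟨⟨k', hk'⟩, h2⟩ := hg _ hk
    exact ⟨⟨_, hk'⟩, fun v hv => (h2 v hv).imp' k.succAbove fun _ h => h⟩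
  have h1 := hface e₁ 1 fun s hs => by
    by_cases h : ∃ k, (s k).1 = 1
    · exact ⟨h, hse s (by simpa only [e₁, if_pos h] using hs)⟩
    · exact absurd (by simp only [e₁, if_neg h]) hs
  have h0 := hface (e - e₁) 0 fun s hs => by
    by_cases h : ∃ k, (s k).1 = 1
    · exact absurd (by simp only [e₁, Pi.sub_apply, if_pos h, sub_self]) hs
    · push Not at h
      refine ⟨⟨0, ?_⟩, hse s ?_⟩
      · have := h 0
        generalize (s 0).1 = i at this ⊢
        revert this; revert i; decide
      · intro h'
        apply hs
        simp only [e₁, Pi.sub_apply, h', ite_self, sub_self]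
  have hb : b₀ - tupleDelta e₁ = b₁ + tupleDelta (e - e₁) := by
    rw [tupleDelta_sub, he]
    abel
  refine ⟨b₀ - tupleDelta e₁, fun s hs => ?_, ?_⟩
  · have hA : (∃ k, (s k).1 = 1) ∧ ∀ v, u (.inr v) < 0 → ∃ k, (s k).2 = v := by
      by_cases h : b₀ s = 0
      · exact h1 s fun h' => hs (by rw [Pi.sub_apply, h, h', sub_zero])
      · exact hs₀ s h
    have hB : (∃ k, (s k).1 = 0) ∧ ∀ v, u (.inr v) < 0 → ∃ k, (s k).2 = v := by
      rw [hb] at hs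
      by_cases h : b₁ s = 0
      · exact h0 s fun h' => hs (by rw [Pi.add_apply, h, h', add_zero])
      · exact hs₁ s h
    rintro (v | v) hv
    · revert v
      rw [Fin.forall_fin_two]
      exact ⟨fun _ => hB.1, fun _ => hA.1⟩
    · exact hA.2 v hv
  · rw [tupleDelta_sub, hb₀, tupleDelta_tupleDelta, sub_zero]

/-- In degree one, the obstruction is the value of the cocycle on a single pair of charts, if all
`x`-exponents are nonnegative. -/
lemma exists_primitive_of_neg_one {u : CoxVar n → ℤ} {j : Fin n} (ht : ∀ i, u (.inl i) < 0)
    (hj : 0 ≤ u (.inr j)) {f : (Fin 2 → ChartIdx n) → K}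
    (hf : ∀ s, f s ≠ 0 → RegularOn u s) (hδ : tupleDelta f = 0)
    (h0 : (∃ v, u (.inr v) < 0) ∨ f ![(0, j), (1, j)] = 0) :
    ∃ b : (Fin 1 → ChartIdx n) → K, (∀ s, b s ≠ 0 → RegularOn u s) ∧ tupleDelta b = f := by
  let b₀ : (Fin 1 → ChartIdx n) → K := fun s => f (Fin.cons (0, j) s)
  let b₁ : (Fin 1 → ChartIdx n) → K := fun s => f (Fin.cons (1, j) s)
  have hb₀ : tupleDelta b₀ = f := tupleDelta_cons_eq hδ _
  have hb₁ : tupleDelta b₁ = f := tupleDelta_cons_eq hδ _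
  have hs₀ : ∀ s, b₀ s ≠ 0 → (∃ k, (s k).1 = 1) ∧ ∀ v, u (.inr v) < 0 → ∃ k, (s k).2 = v :=
    fun s => exists_eq_of_cons_ne_zero ht hj hf one_ne_zero
  have hs₁ : ∀ s, b₁ s ≠ 0 → (∃ k, (s k).1 = 0) ∧ ∀ v, u (.inr v) < 0 → ∃ k, (s k).2 = v :=
    fun s => exists_eq_of_cons_ne_zero ht hj hf zero_ne_one
  -- the difference of the two primitives is constant, and vanishes on the chart `(1, j)`
  have hconst : ∀ s, (b₀ - b₁) s = (b₀ - b₁) ![(1, j)] := by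
    intro s
    have h := tupleDelta_cons_eq (f := b₀ - b₁)
      (by rw [tupleDelta_sub, hb₀, hb₁, sub_self]) (1, j)
    rw [← congrFun h s, tupleDelta]
    simp only [Nat.reduceAdd, Finset.univ_unique, Fin.default_eq_zero, Finset.sum_singleton]
    rw [Fin.val_zero, pow_zero, one_mul]
    refine congrArg (b₀ - b₁) (funext fun k => ?_)
    fin_cases k
    rfl
  have hz₁ : b₁ ![(1, j)] = 0 := by
    by_contra h
    obtain ⟨⟨k, hk⟩, -⟩ := hs₁ _ h
    rw [Subsingleton.elim k 0] at hk
    exact one_ne_zero hk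
  have hz₀ : b₀ ![(1, j)] = 0 := by
    rcases h0 with ⟨v, hv⟩ | h0
    · by_contra h
      obtain ⟨k, hk⟩ := (hs₀ _ h).2 v hv
      rw [Subsingleton.elim k 0] at hk
      exact absurd hv (not_lt.mpr ((show j = v from hk) ▸ hj))
    · exact h0
  have heq : b₀ = b₁ := by
    funext s
    have h := hconst s
    rw [Pi.sub_apply, Pi.sub_apply, hz₀, hz₁, sub_zero, sub_eq_zero] at h
    exact h
  refine ⟨b₀, fun s hs => ?_, hb₀⟩
  have hA := hs₀ s hs
  have hB := hs₁ s (heq ▸ hs)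
  rintro (v | v) hv
  · revert v
    rw [Fin.forall_fin_two]
    exact ⟨fun _ => hB.1, fun _ => hA.1⟩
  · exact hA.2 v hv

end pointwise

end Scrolls

namespace Scrolls

lemma eq_add_one_of_ne : ∀ {v w : Fin 2}, w ≠ v → w = v + 1 := by
  decide

section cohomology

variable {K : Type} [Field K] {n : ℕ} {a : Fin n → ℤ} {D : ℤ × ℤ}

lemma mem_cochains_iff {p : ℕ} {c : (Fin (p + 1) → ChartIdx n) → Laurent K n} :
    c ∈ cochains K a D p ↔ ∀ s u, c s u ≠ 0 → bidegree a u = D ∧ RegularOn u s := by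
  simp only [cochains, Submodule.mem_pi, Set.mem_univ, true_imp_iff, sections,
    Finsupp.mem_supported, Set.subset_def, Finset.mem_coe, Finsupp.mem_support_iff]
  rfl

lemma delta_apply {p : ℕ} (c : (Fin (p + 1) → ChartIdx n) → Laurent K n)
    (s : Fin (p + 2) → ChartIdx n) (u : CoxVar n → ℤ) :
    delta K n p c s u = tupleDelta (fun s' => c s' u) s := by
  simp [delta, tupleDelta, Finsupp.finsetSum_apply]

lemma mem_cocycles_iff {p : ℕ} {c : (Fin (p + 1) → ChartIdx n) → Laurent K n} :
    c ∈ cocycles K a D p ↔ (∀ s u, c s u ≠ 0 → bidegree a u = D ∧ RegularOn u s) ∧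
      ∀ u, tupleDelta (fun s => c s u) = 0 := by
  rw [cocycles, Submodule.mem_inf, mem_cochains_iff, LinearMap.mem_ker]
  refine and_congr_right fun _ => ⟨fun h u => ?_, fun h => ?_⟩
  · funext s
    rw [← delta_apply, h]
    rfl
  · funext s
    ext u
    rw [delta_apply, h]
    rfl

/-- A Čech cocycle is a coboundary if its components for all Laurent monomials are. -/
lemma mem_coboundaries_of_forall {p : ℕ} {c : (Fin (p + 2) → ChartIdx n) → Laurent K n}
    (hc : c ∈ cocycles K a D (p + 1))
    (h : ∀ u, bidegree a u = D → ∃ b : (Fin (p + 1) → ChartIdx n) → K,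
      (∀ s, b s ≠ 0 → RegularOn u s) ∧ tupleDelta b = fun s => c s u) :
    c ∈ coboundaries K a D (p + 1) := by
  classical
  rw [mem_cocycles_iff] at hc
  have h' : ∀ u, ∃ b : (Fin (p + 1) → ChartIdx n) → K,
      (∀ s, b s ≠ 0 → bidegree a u = D ∧ RegularOn u s) ∧ (tupleDelta b = fun s => c s u) ∧
      ((∀ s, c s u = 0) → b = 0) := by
    intro u
    by_cases hu : ∀ s, c s u = 0
    · refine ⟨0, fun s hs => absurd rfl hs, ?_, fun _ => rfl⟩
      funext s
      simp [tupleDelta, hu]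
    · obtain ⟨s, hs⟩ := not_forall.mp hu
      obtain ⟨b, h1, h2⟩ := h u (hc.1 s u hs).1
      exact ⟨b, fun s' hs' => ⟨(hc.1 s u hs).1, h1 s' hs'⟩, h2, fun h => absurd h hu⟩
  choose b h1 h2 h3 using h'
  let B : (Fin (p + 1) → ChartIdx n) → Laurent K n := fun s =>
    Finsupp.onFinset (Finset.univ.biUnion fun s' => (c s').support) (fun u => b u s) fun u hu => by
      by_contra hu'
      simp only [Finset.mem_biUnion, Finset.mem_univ, true_and, not_exists,
        Finsupp.mem_support_iff, not_not] at hu'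
      exact hu (congrFun (h3 u hu') s)
  refine ⟨B, mem_cochains_iff.mpr fun s u hs => h1 u s hs, ?_⟩
  funext s
  ext u
  rw [delta_apply]
  exact congrFun (h2 u) s

lemma bidegree_snd (u : CoxVar n → ℤ) : (bidegree a u).2 = ∑ j, u (.inr j) := by
  simp [bidegree, varDegree, Prod.snd_sum]

lemma bidegree_fst (u : CoxVar n → ℤ) :
    (bidegree a u).1 = u (.inl 0) + u (.inl 1) - ∑ j, a j * u (.inr j) := by
  simp [bidegree, varDegree, Prod.fst_sum, mul_comm, sub_eq_add_neg]

lemma exists_nonneg_of_bidegree [NeZero n] (hD : 0 ≤ D.2) {u : CoxVar n → ℤ}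
    (hu : bidegree a u = D) : ∃ j, 0 ≤ u (.inr j) := by
  by_contra! h
  have h1 : ∑ j, u (.inr j) < 0 :=
    Finset.sum_neg (fun j _ => h j) ⟨0, Finset.mem_univ _⟩
  rw [← bidegree_snd (a := a), hu] at h1
  omega

/-- The scroll is a bundle of projective spaces over `ℙ¹`, so a line bundle of nonnegative degree on
the fibres has cohomology in degrees zero and one only. -/
theorem subsingleton_cohomology [NeZero n] (hD : 0 ≤ D.2) (p : ℕ) :
    Subsingleton (Cohomology K a D (p + 2)) := by
  rw [Cohomology, Submodule.Quotient.subsingleton_iff, Submodule.submoduleOf_eq_top]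
  intro c hc
  refine mem_coboundaries_of_forall hc fun u hu => ?_
  obtain ⟨h1, h2⟩ := mem_cocycles_iff.mp hc
  obtain ⟨j, hj⟩ := exists_nonneg_of_bidegree hD hu
  by_cases ht : ∀ i, u (.inl i) < 0
  · exact exists_primitive_of_neg ht hj (fun s hs => (h1 s u hs).2) (h2 u)
  · push Not at ht
    obtain ⟨i, hi⟩ := ht
    exact exists_primitive_of_nonneg hi hj (fun s hs => (h1 s u hs).2) (h2 u)

/-- The exponents of the monomials that form a basis of `H⁰`. -/
def exponents₀ (a : Fin n → ℤ) (D : ℤ × ℤ) : Set (CoxVar n → ℤ) :=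
  {u | bidegree a u = D ∧ ∀ v, 0 ≤ u v}

/-- The exponents of the Laurent monomials that form a basis of `H¹`. -/
def exponents₁ (a : Fin n → ℤ) (D : ℤ × ℤ) : Set (CoxVar n → ℤ) :=
  {u | bidegree a u = D ∧ (∀ i, u (.inl i) < 0) ∧ ∀ j, 0 ≤ u (.inr j)}

lemma finite_and_finrank_of_range_supported {V : Type*} [AddCommGroup V] [Module K V] {σ : Type}
    (N : Submodule K V) (L : V →ₗ[K] σ →₀ K) (U : Set σ) [Finite U]
    (hker : LinearMap.ker L = N) (hrange : LinearMap.range L = Finsupp.supported K K U) :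
    Module.Finite K (V ⧸ N) ∧ Module.finrank K (V ⧸ N) = Nat.card U := by
  subst hker
  have e : (V ⧸ LinearMap.ker L) ≃ₗ[K] (U →₀ K) :=
    L.quotKerEquivRange.trans ((LinearEquiv.ofEq _ _ hrange).trans
      (Finsupp.supportedEquivFinsupp U))
  have := Fintype.ofFinite U
  refine ⟨Module.Finite.equiv e.symm, ?_⟩
  rw [e.finrank_eq, Module.finrank_finsupp_self, Nat.card_eq_fintype_card]

/-- A Čech cocycle of degree zero has the same value on all charts, and with two values of each
index every variable is non-invertible on some chart. -/
theorem cohomology_zero (hn : 2 ≤ n) [Finite (exponents₀ a D)] :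
    Module.Finite K (Cohomology K a D 0) ∧
      Module.finrank K (Cohomology K a D 0) = Nat.card (exponents₀ a D) := by
  have : NeZero n := ⟨by omega⟩
  let L : cocycles K a D 0 →ₗ[K] Laurent K n :=
    (LinearMap.proj (![(0, 0)] : Fin 1 → ChartIdx n)).comp (cocycles K a D 0).subtype
  have hconst : ∀ c ∈ cocycles K a D 0, ∀ s u, c s u = c ![(0, 0)] u := by
    intro c hc s u
    have h := congrFun (tupleDelta_cons_eq ((mem_cocycles_iff.mp hc).2 u) (0, 0)) s
    rw [tupleDelta, Fin.sum_univ_one, Fin.val_zero, pow_zero, one_mul] at h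
    rw [← h]
    refine congrArg (fun s' => c s' u) (funext fun k => ?_)
    obtain rfl := Fin.fin_one_eq_zero k
    rfl
  refine finite_and_finrank_of_range_supported _ L _ ?_ ?_
  · rw [show coboundaries K a D 0 = ⊥ from rfl]
    ext ⟨c, hc⟩
    rw [LinearMap.mem_ker, Submodule.submoduleOf, Submodule.mem_comap, Submodule.mem_bot]
    constructor
    · intro h
      funext s
      ext u
      exact (hconst c hc s u).trans (DFunLike.congr_fun h u)
    · intro h
      exact congrFun h _
  · ext g
    constructor
    · rintro ⟨⟨c, hc⟩, rfl⟩
      refine (Finsupp.mem_supported _ _).mpr fun u hu => ?_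
      have hu' : c ![(0, 0)] u ≠ 0 := Finsupp.mem_support_iff.mp hu
      have hreg := fun s => (mem_cocycles_iff.mp hc).1 s u (by rwa [hconst c hc])
      refine ⟨(hreg ![(0, 0)]).1, fun v => ?_⟩
      by_contra! hv
      rcases v with v | v
      · -- a chart where `t_v` is not invertible
        obtain ⟨k, hk⟩ := (hreg ![(v + 1, 0)]).2 _ hv
        rw [Fin.fin_one_eq_zero k] at hk
        revert hk
        revert v
        simp
      · obtain ⟨k, hk⟩ := (hreg ![(0, if v = 0 then ⟨1, by omega⟩ else 0)]).2 _ hv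
        rw [Fin.fin_one_eq_zero k] at hk
        simp only [Matrix.cons_val_fin_one] at hk
        split_ifs at hk with h0
        · rw [h0] at hk
          exact absurd (congrArg Fin.val hk) (by simp)
        · exact h0 hk.symm
    · intro hg
      rw [Finsupp.mem_supported] at hg
      refine ⟨⟨fun _ => g, mem_cocycles_iff.mpr ⟨fun s u hu => ?_, fun u => ?_⟩⟩, rfl⟩
      · have h := hg (Finsupp.mem_support_iff.mpr hu)
        exact ⟨h.1, fun v hv => absurd hv (not_lt.mpr (h.2 v))⟩
      · funext s
        simp [tupleDelta, Fin.sum_univ_succ]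

/-- The class of a Čech cocycle of degree one is given by the part of its value on the pair of
charts `(0, 0)`, `(1, 0)` with exponents in `exponents₁`. -/
theorem cohomology_one [NeZero n] (hD : 0 ≤ D.2) [Finite (exponents₁ a D)] :
    Module.Finite K (Cohomology K a D 1) ∧
      Module.finrank K (Cohomology K a D 1) = Nat.card (exponents₁ a D) := by
  classical
  let s₀ : Fin 2 → ChartIdx n := ![(0, 0), (1, 0)]
  let L : cocycles K a D 1 →ₗ[K] Laurent K n :=
    (Finsupp.supported K K (exponents₁ a D)).subtype.comp
      ((Finsupp.restrictDom K K (exponents₁ a D)).comp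
        ((LinearMap.proj s₀).comp (cocycles K a D 1).subtype))
  have hL : ∀ c u, L c u = if u ∈ exponents₁ a D then c.1 s₀ u else 0 := fun c u => by
    simp only [L, LinearMap.comp_apply, Submodule.subtype_apply, Finsupp.restrictDom_apply,
      LinearMap.proj_apply, Finsupp.filter_apply]
  refine finite_and_finrank_of_range_supported _ L _ ?_ ?_
  · ext ⟨c, hc⟩
    rw [LinearMap.mem_ker, Submodule.submoduleOf, Submodule.mem_comap]
    obtain ⟨h1, h2⟩ := mem_cocycles_iff.mp hc
    constructor
    · intro hL0
      refine mem_coboundaries_of_forall hc fun u hu => ?_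
      by_cases ht : ∀ i, u (.inl i) < 0
      · by_cases hx : ∃ v, u (.inr v) < 0
        · obtain ⟨j, hj⟩ := exists_nonneg_of_bidegree hD hu
          exact exists_primitive_of_neg_one ht hj (fun s hs => (h1 s u hs).2) (h2 u) (.inl hx)
        · push Not at hx
          refine exists_primitive_of_neg_one ht (hx 0) (fun s hs => (h1 s u hs).2) (h2 u) (.inr ?_)
          have h := hL ⟨c, hc⟩ u
          rw [hL0, if_pos ⟨hu, ht, hx⟩] at h
          exact h.symm
      · push Not at ht
        obtain ⟨i, hi⟩ := ht
        obtain ⟨j, hj⟩ := exists_nonneg_of_bidegree hD hu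
        exact exists_primitive_of_nonneg hi hj (fun s hs => (h1 s u hs).2) (h2 u)
    · rintro ⟨b, hb, rfl⟩
      ext u
      rw [hL]
      split_ifs with hu
      · -- no single chart is contained in `t₁ t₂ ≠ 0`
        have hb0 : ∀ s, b s u = 0 := fun s => by
          by_contra hs
          have hreg := (mem_cochains_iff.mp hb s u hs).2
          obtain ⟨k, hk⟩ := hreg (.inl 0) (hu.2.1 0)
          obtain ⟨k', hk'⟩ := hreg (.inl 1) (hu.2.1 1)
          rw [Subsingleton.elim (α := Fin 1) k' k, hk] at hk'
          exact zero_ne_one hk'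
        change delta K n 0 b s₀ u = 0
        rw [delta_apply]
        simp [tupleDelta, hb0]
      · rfl
  · ext g
    constructor
    · rintro ⟨c, rfl⟩
      exact Subtype.prop _
    · intro hg
      rw [Finsupp.mem_supported] at hg
      -- the coboundary of `g` on the charts with `t₂ ≠ 0`, taken outside the cochains of `𝒪(D)`
      let b : (Fin 1 → ChartIdx n) → Laurent K n := fun s => if (s 0).1 = 1 then g else 0
      have hbu : ∀ u s, b s u = if (s 0).1 = 1 then g u else 0 := fun u s => by
        simp only [b]
        split_ifs <;> rfl
      refine ⟨⟨delta K n 0 b, mem_cocycles_iff.mpr ⟨fun s u hu => ?_, fun u => ?_⟩⟩, ?_⟩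
      · rw [delta_apply] at hu
        have hgu : g u ≠ 0 := by
          intro h
          apply hu
          simp [tupleDelta, hbu, h]
        have h := hg (Finsupp.mem_support_iff.mpr hgu)
        refine ⟨h.1, ?_⟩
        rintro (v | v) hv
        · by_contra hne
          have hall : ∀ k, (s k).1 = v + 1 := fun k => by
            have h3 : (s k).1 ≠ v := fun h => hne ⟨k, h⟩
            exact eq_add_one_of_ne h3
          apply hu
          simp [tupleDelta, hbu, hall, Fin.sum_univ_succ]
        · exact absurd hv (not_lt.mpr (h.2.2 v))
      · simp only [delta_apply]
        exact tupleDelta_tupleDelta _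
      · ext u
        rw [hL]
        split_ifs with hu
        · rw [delta_apply]
          simp [tupleDelta, hbu, s₀, Fin.sum_univ_succ]
        · by_contra h
          exact hu (hg (Finsupp.mem_support_iff.mpr (Ne.symm h)))

theorem hasEulerChar (hn : 2 ≤ n) (hD : 0 ≤ D.2) [Finite (exponents₀ a D)]
    [Finite (exponents₁ a D)] :
    HasEulerChar K a D (Nat.card (exponents₀ a D) - Nat.card (exponents₁ a D)) := by
  have : NeZero n := ⟨by omega⟩
  have h0 := cohomology_zero (K := K) (a := a) (D := D) hn
  have h1 := cohomology_one (K := K) (a := a) hD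
  refine ⟨fun p => ?_, 2, fun p hp => ?_, ?_⟩
  · match p with
    | 0 => exact h0.1
    | 1 => exact h1.1
    | p + 2 =>
      have := subsingleton_cohomology (K := K) (a := a) hD p
      exact Module.Finite.of_finite
  · obtain ⟨p, rfl⟩ := Nat.exists_eq_add_of_le' hp
    exact subsingleton_cohomology hD p
  · rw [Finset.sum_range_succ, Finset.sum_range_one, h0.2, h1.2]
    ring

end cohomology

end Scrolls

/-! ### The homogeneous coordinate ring of `Q` -/

/-- A recursive description of the set of all sums of `d` members of a family `ev`. -/
lemma Finsupp.image_linearCombination_degree_eq {σ M : Type*} [AddCommMonoid M] (ev : σ → M)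
    (E : ℕ → Set M) (h0 : E 0 = {0})
    (hs : ∀ d m, m ∈ E (d + 1) ↔ ∃ l, ∃ m' ∈ E d, ev l + m' = m) (d : ℕ) :
    Finsupp.linearCombination ℕ ev '' {w | w.degree = d} = E d := by
  classical
  induction d with
  | zero => simp [h0, Finsupp.degree_eq_zero_iff]
  | succ d ih =>
    ext m
    rw [hs]
    constructor
    · rintro ⟨w, hw, rfl⟩
      obtain ⟨l, hl⟩ : ∃ l, w l ≠ 0 := by
        by_contra! h
        rw [Set.mem_ofPred_eq, (DFunLike.ext _ _ h : w = 0), map_zero] at hw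
        omega
      have hle : Finsupp.single l 1 ≤ w := by
        rw [Finsupp.single_le_iff]
        omega
      obtain ⟨w', rfl⟩ := exists_add_of_le hle
      refine ⟨l, _, ih.subset (Set.mem_image_of_mem _ (?_ : w'.degree = d)), ?_⟩
      · rw [Set.mem_ofPred_eq, map_add, Finsupp.degree_single] at hw
        omega
      · rw [map_add, Finsupp.linearCombination_single, one_smul]
    · rintro ⟨l, m', hm', rfl⟩
      rw [← ih] at hm'
      obtain ⟨w, hw, rfl⟩ := hm'
      refine ⟨Finsupp.single l 1 + w, ?_, ?_⟩
      · rw [Set.mem_ofPred_eq] at hw ⊢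
        rw [map_add, Finsupp.degree_single, hw, add_comm]
      · rw [map_add, Finsupp.linearCombination_single, one_smul]

namespace HalfAnti

open ProjSp Scrolls Coord

/-- The exponents of the monomial `t_1^i t_2^j x_m x_n`. -/
def exponent (l : Coord) : CoxVar 4 →₀ ℕ :=
  Finsupp.equivFunOnFinite.symm (Sum.elim ![l.idx.1, l.idx.2.1] fun j =>
    (if l.idx.2.2.1 = j then 1 else 0) + if l.idx.2.2.2 = j then 1 else 0)

lemma torusMap_X (l : Coord) : torusMap (X l) = monomial (exponent l) 1 := by
  rw [monomial_eq, Finsupp.prod_fintype _ _ (fun _ => pow_zero _)]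
  cases l <;> simp [torusMap, exponent, idx, Fin.prod_univ_succ] <;> ring

lemma torusMap_monomial (w : Coord →₀ ℕ) :
    torusMap (monomial w 1) = monomial (Finsupp.linearCombination ℕ exponent w) 1 := by
  induction w using Finsupp.induction_linear with
  | zero => simp
  | add v w hv hw => rw [← mul_one (1 : ℂ), ← monomial_mul, map_mul, hv, hw, monomial_mul, map_add]
  | single l k =>
    rw [← X_pow_eq_monomial, map_pow, torusMap_X, monomial_pow, one_pow,
      Finsupp.linearCombination_single]

/-- The exponents of the products of `d` of the monomials `t_1^i t_2^j x_m x_n`. -/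
def exponentsQ (d : ℕ) : Set (CoxVar 4 →₀ ℕ) :=
  {e | e (.inr 0) + e (.inr 1) + e (.inr 2) + e (.inr 3) = 2 * d ∧ e (.inr 0) ≤ d ∧
    e (.inl 0) + e (.inl 1) + d = e (.inr 1) + e (.inr 2) + 2 * e (.inr 3)}

lemma exponent_mem (l : Coord) : exponent l ∈ exponentsQ 1 := by
  cases l <;> exact ⟨rfl, by decide, rfl⟩

/-- Each exponent in `exponentsQ (d + 1)` allows to split off one of the monomials
`t_1^i t_2^j x_m x_n`, and one with `x₁` if `x₁` occurs, as required by the bound on the exponent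
of `x₁`. -/
lemma exists_exponent_le {d : ℕ} {e : CoxVar 4 →₀ ℕ} (he : e ∈ exponentsQ (d + 1)) :
    ∃ l, (∀ v, exponent l v ≤ e v) ∧ e (.inr 0) ≤ d + exponent l (.inr 0) := by
  obtain ⟨h1, h2, h3⟩ := he
  suffices h : ∃ l : Coord, l.idx.1 ≤ e (.inl 0) ∧ l.idx.2.1 ≤ e (.inl 1) ∧
      exponent l (.inr 0) ≤ e (.inr 0) ∧ exponent l (.inr 1) ≤ e (.inr 1) ∧
      exponent l (.inr 2) ≤ e (.inr 2) ∧ exponent l (.inr 3) ≤ e (.inr 3) ∧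
      e (.inr 0) ≤ d + exponent l (.inr 0) by
    obtain ⟨l, h4, h5, h6, h7, h8, h9, h10⟩ := h
    refine ⟨l, ?_, h10⟩
    rintro (v | v) <;> fin_cases v <;> assumption
  generalize e (.inl 0) = p, e (.inl 1) = q, e (.inr 0) = x, e (.inr 1) = y, e (.inr 2) = z,
    e (.inr 3) = w at *
  by_cases hx : 1 ≤ x
  · by_cases hy : 1 ≤ y
    · exact ⟨y0012, by simp [exponent, idx]; omega⟩
    by_cases hz : 1 ≤ z
    · exact ⟨y0013, by simp [exponent, idx]; omega⟩
    by_cases hp : 1 ≤ p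
    · exact ⟨y1014, by simp [exponent, idx]; omega⟩
    · exact ⟨y0114, by simp [exponent, idx]; omega⟩
  · rcases (by omega : 2 ≤ y + z ∨ y + z = 1 ∨ y + z = 0) with h | h | h
    · by_cases hp : 1 ≤ p
      · by_cases hy : 2 ≤ y
        · exact ⟨y1022, by simp [exponent, idx]; omega⟩
        by_cases hz : 2 ≤ z
        · exact ⟨y1033, by simp [exponent, idx]; omega⟩
        · exact ⟨y1023, by simp [exponent, idx]; omega⟩
      · by_cases hy : 2 ≤ y
        · exact ⟨y0122, by simp [exponent, idx]; omega⟩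
        by_cases hz : 2 ≤ z
        · exact ⟨y0133, by simp [exponent, idx]; omega⟩
        · exact ⟨y0123, by simp [exponent, idx]; omega⟩
    · rcases (by omega : 2 ≤ p ∨ p = 1 ∨ p = 0) with hp | hp | hp
      · by_cases hy : 1 ≤ y
        · exact ⟨y2024, by simp [exponent, idx]; omega⟩
        · exact ⟨y2034, by simp [exponent, idx]; omega⟩
      · by_cases hy : 1 ≤ y
        · exact ⟨y1124, by simp [exponent, idx]; omega⟩
        · exact ⟨y1134, by simp [exponent, idx]; omega⟩
      · by_cases hy : 1 ≤ y
        · exact ⟨y0224, by simp [exponent, idx]; omega⟩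
        · exact ⟨y0234, by simp [exponent, idx]; omega⟩
    · rcases (by omega : 3 ≤ p ∨ p = 2 ∨ p = 1 ∨ p = 0) with hp | hp | hp | hp
      · exact ⟨y3044, by simp [exponent, idx]; omega⟩
      · exact ⟨y2144, by simp [exponent, idx]; omega⟩
      · exact ⟨y1244, by simp [exponent, idx]; omega⟩
      · exact ⟨y0344, by simp [exponent, idx]; omega⟩

lemma mem_exponentsQ_succ (d : ℕ) (e : CoxVar 4 →₀ ℕ) :
    e ∈ exponentsQ (d + 1) ↔ ∃ l, ∃ e' ∈ exponentsQ d, exponent l + e' = e := by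
  constructor
  · intro he
    obtain ⟨l, hl, h0⟩ := exists_exponent_le he
    obtain ⟨e', rfl⟩ := exists_add_of_le (Finsupp.le_def.mpr hl)
    refine ⟨l, e', ?_, rfl⟩
    have h1 := exponent_mem l
    simp only [exponentsQ, Set.mem_ofPred_eq, Finsupp.add_apply] at he h0 h1 ⊢
    omega
  · rintro ⟨l, e', he', rfl⟩
    have h1 := exponent_mem l
    simp only [exponentsQ, Set.mem_ofPred_eq, Finsupp.add_apply] at he' h1 ⊢
    omega

lemma exponentsQ_zero : exponentsQ 0 = {0} := by
  ext e
  constructor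
  · rintro ⟨h1, h2, h3⟩
    ext v
    rw [Finsupp.zero_apply]
    rcases v with v | v
    · match v with
      | 0 => omega
      | 1 => omega
    · match v with
      | 0 => omega
      | 1 => omega
      | 2 => omega
      | 3 => omega
  · rintro rfl
    exact ⟨rfl, le_rfl, rfl⟩

lemma map_torusMap_grading (d : ℕ) :
    (grading Coord d).map torusMap.toLinearMap = restrictSupport ℂ (exponentsQ d) := by
  have h : grading Coord d = restrictSupport ℂ {w | w.degree = d} :=
    homogeneousSubmodule_eq_finsupp_supported _ _ _
  rw [h, restrictSupport_eq_span, restrictSupport_eq_span, Submodule.map_span,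
    ← Finsupp.image_linearCombination_degree_eq exponent exponentsQ exponentsQ_zero
      mem_exponentsQ_succ, Set.image_image, Set.image_image]
  refine congrArg _ (Set.image_congr fun w _ => torusMap_monomial w)

/-- The homogeneous coordinate ring of `Q` is the subring of the Cox ring that is generated by
the monomials `t_1^i t_2^j x_m x_n`. -/
lemma hilbertFunction_Q (d : ℕ) : hilbertFunction Q d = Nat.card (exponentsQ d) := by
  let L : grading Coord d →ₗ[ℂ] MvPolynomial (CoxVar 4) ℂ :=
    torusMap.toLinearMap.domRestrict (grading Coord d)
  have hker : ((homogeneousIdeal Q).restrictScalars ℂ).submoduleOf (grading Coord d) =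
      LinearMap.ker L := by
    ext f
    rw [homogeneousIdeal_Q]
    exact mem_genericQ f.2
  have hrange : LinearMap.range L = restrictSupport ℂ (exponentsQ d) := by
    rw [← map_torusMap_grading, LinearMap.range_domRestrict]
  rw [hilbertFunction, hker, L.quotKerEquivRange.finrank_eq, hrange,
    Module.finrank_eq_nat_card_basis (basisRestrictSupport ℂ (exponentsQ d))]

end HalfAnti

namespace HalfAnti

open ProjSp Scrolls Coord

/-! ### Counting monomials -/

lemma bidegree_eq_iff {m : ℕ} {u : CoxVar 4 → ℤ} :
    bidegree twists u = m • halfAnticanonical ↔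
      u (.inl 0) + u (.inl 1) + m = u (.inr 1) + u (.inr 2) + 2 * u (.inr 3) ∧
        u (.inr 0) + u (.inr 1) + u (.inr 2) + u (.inr 3) = 2 * m := by
  rw [Prod.ext_iff, bidegree_fst, bidegree_snd]
  simp only [Fin.sum_univ_four, twists, halfAnticanonical, Prod.smul_mk, nsmul_eq_mul,
    Matrix.cons_val]
  constructor <;> rintro ⟨h1, h2⟩ <;> constructor <;> linarith

/-- The Laurent monomials of bidegree `-mK/2` in which the exponents of the `x_j` are nonnegative
are parametrized by the degree `s` in `x₂, x₃, x₄`, the exponents `c` of `x₄` and `a` of `x₂`, and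
the exponent `p` of `t₁`. -/
def laurentExponent (m s c a : ℕ) (p : ℤ) : CoxVar 4 → ℤ :=
  Sum.elim ![p, s + c - m - p] ![2 * m - s, a, s - c - a, c]

lemma laurentExponent_injective {m s c a s' c' a' : ℕ} {p p' : ℤ}
    (h : laurentExponent m s c a p = laurentExponent m s' c' a' p') :
    s = s' ∧ c = c' ∧ a = a' ∧ p = p' := by
  have h0 : (2 * m - s : ℤ) = 2 * m - s' := congrFun h (.inr 0)
  have h1 : (a : ℤ) = a' := congrFun h (.inr 1)
  have h3 : (c : ℤ) = c' := congrFun h (.inr 3)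
  have h4 : p = p' := congrFun h (.inl 0)
  omega

lemma exists_laurentExponent {m : ℕ} {u : CoxVar 4 → ℤ}
    (hu : bidegree twists u = m • halfAnticanonical) (hx : ∀ j, 0 ≤ u (.inr j)) :
    ∃ s c a : ℕ, c ≤ s ∧ a ≤ s - c ∧ s ≤ 2 * m ∧ laurentExponent m s c a (u (.inl 0)) = u := by
  obtain ⟨h1, h2⟩ := bidegree_eq_iff.mp hu
  have hx0 := hx 0
  have hx1 := hx 1
  have hx2 := hx 2
  have hx3 := hx 3
  refine ⟨(2 * m - u (.inr 0)).toNat, (u (.inr 3)).toNat, (u (.inr 1)).toNat, by omega, by omega,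
    by omega, ?_⟩
  funext v
  rcases v with v | v <;> fin_cases v <;> simp [laurentExponent] <;> omega

lemma bidegree_laurentExponent (m s c a : ℕ) (p : ℤ) :
    bidegree twists (laurentExponent m s c a p) = m • halfAnticanonical := by
  rw [bidegree_eq_iff]
  simp only [laurentExponent, Sum.elim_inl, Sum.elim_inr, Matrix.cons_val]
  constructor <;> ring

/-- Counts a set of exponents in which `s` is in `A`, and there are `g s c` possible exponents
`p i` of `t₁`; there are `s - c + 1` possible exponents `a`. -/
lemma finite_and_card_of_laurentExponent {m : ℕ} {U : Set (CoxVar 4 → ℤ)} (A : Finset ℕ)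
    (g : ℕ → ℕ → ℕ) (p : ℕ → ℤ) (hp : p.Injective)
    (hU : ∀ u, u ∈ U ↔ ∃ s ∈ A, ∃ c ≤ s, ∃ a ≤ s - c, ∃ i < g s c,
      laurentExponent m s c a (p i) = u) :
    Finite U ∧ Nat.card U = ∑ s ∈ A, ∑ c ∈ Finset.range (s + 1), (s - c + 1) * g s c := by
  let T : Finset (Σ _ : ℕ, Σ _ : ℕ, ℕ × ℕ) := A.sigma fun s => (Finset.range (s + 1)).sigma fun c =>
    Finset.range (s - c + 1) ×ˢ Finset.range (g s c)
  let F : (Σ _ : ℕ, Σ _ : ℕ, ℕ × ℕ) → CoxVar 4 → ℤ := fun x =>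
    laurentExponent m x.1 x.2.1 x.2.2.1 (p x.2.2.2)
  have hF : F.Injective := by
    rintro ⟨s, c, a, i⟩ ⟨s', c', a', i'⟩ h
    obtain ⟨rfl, rfl, rfl, h⟩ := laurentExponent_injective h
    obtain rfl : i = i' := hp h
    rfl
  have hFT : U = F '' T := by
    ext u
    simp only [hU, Set.mem_image, Finset.mem_coe, T, F, Finset.mem_sigma, Finset.mem_product,
      Finset.mem_range, Nat.lt_succ_iff, Sigma.exists, Prod.exists]
    constructor
    · rintro ⟨s, hs, c, hc, a, ha, i, hi, h⟩
      exact ⟨s, c, a, i, ⟨hs, hc, ha, hi⟩, h⟩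
    · rintro ⟨s, c, a, i, ⟨hs, hc, ha, hi⟩, h⟩
      exact ⟨s, hs, c, hc, a, ha, i, hi, h⟩
  subst hFT
  refine ⟨inferInstance, ?_⟩
  rw [Nat.card_coe_set_eq, Set.ncard_image_of_injective _ hF, Set.ncard_coe_finset]
  simp [T, Finset.card_sigma]

/-- With `b = 2m`, this counts the basis of `H⁰` of `-mK/2`, and with `b = m` the part of it that is
spanned by products of sections of `-K/2`. -/
lemma finite_and_card_exponents₀_le {m b : ℕ} (hb : b ≤ 2 * m) :
    Finite {u ∈ exponents₀ twists (m • halfAnticanonical) | u (.inr 0) ≤ b} ∧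
      Nat.card {u ∈ exponents₀ twists (m • halfAnticanonical) | u (.inr 0) ≤ b} =
        ∑ s ∈ Finset.Ico (2 * m - b) (2 * m + 1), ∑ c ∈ Finset.range (s + 1),
          (s - c + 1) * (s + c + 1 - m) := by
  refine finite_and_card_of_laurentExponent (m := m) _ _ (fun i => i) Nat.cast_injective fun u => ?_
  simp only [exponents₀, Finset.mem_Ico]
  constructor
  · rintro ⟨⟨hu, h0⟩, hub⟩
    obtain ⟨s, c, a, hc, ha, hs, h⟩ := exists_laurentExponent hu fun j => h0 (.inr j)
    have h1 := h0 (.inl 0)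
    have h2 := h0 (.inl 1)
    have h3 : (s + c - m - u (.inl 0) : ℤ) = u (.inl 1) := congrFun h (.inl 1)
    have h4 : (2 * m - s : ℤ) = u (.inr 0) := congrFun h (.inr 0)
    refine ⟨s, by omega, c, hc, a, ha, (u (.inl 0)).toNat, by omega, ?_⟩
    rw [Int.toNat_of_nonneg h1, h]
  · rintro ⟨s, hs, c, hc, a, ha, i, hi, rfl⟩
    refine ⟨⟨bidegree_laurentExponent _ _ _ _ _, ?_⟩, ?_⟩
    · rintro (v | v) <;> fin_cases v <;> simp [laurentExponent] <;> omega
    · simp only [laurentExponent, Sum.elim_inr, Matrix.cons_val]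
      omega

lemma finite_and_card_exponents₁ (m : ℕ) :
    Finite (exponents₁ twists (m • halfAnticanonical)) ∧
      Nat.card (exponents₁ twists (m • halfAnticanonical)) =
        ∑ s ∈ Finset.range (2 * m + 1), ∑ c ∈ Finset.range (s + 1),
          (s - c + 1) * (m - 1 - (s + c)) := by
  refine finite_and_card_of_laurentExponent (m := m) _ _ (fun i => -1 - i)
    (fun i j h => by simpa using h) fun u => ?_
  simp only [exponents₁, Finset.mem_range]
  constructor
  · rintro ⟨hu, ht, hx⟩
    obtain ⟨s, c, a, hc, ha, hs, h⟩ := exists_laurentExponent hu hx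
    have h1 := ht 0
    have h2 := ht 1
    have h3 : (s + c - m - u (.inl 0) : ℤ) = u (.inl 1) := congrFun h (.inl 1)
    refine ⟨s, by omega, c, hc, a, ha, (-1 - u (.inl 0)).toNat, by omega, ?_⟩
    rw [Int.toNat_of_nonneg (by omega), sub_sub_cancel, h]
  · rintro ⟨s, hs, c, hc, a, ha, i, hi, rfl⟩
    refine ⟨bidegree_laurentExponent _ _ _ _ _, fun v => ?_, fun v => ?_⟩ <;>
      fin_cases v <;> simp [laurentExponent] <;> omega

lemma card_exponentsQ (d : ℕ) :
    Nat.card (exponentsQ d) =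
      Nat.card {u ∈ exponents₀ twists (d • halfAnticanonical) | u (.inr 0) ≤ d} := by
  have hinj : Function.Injective fun (e : CoxVar 4 →₀ ℕ) v => (e v : ℤ) := fun e e' h =>
    Finsupp.ext fun v => Nat.cast_injective (congrFun h v)
  rw [← Nat.card_image_of_injective hinj]
  congr 2
  ext u
  constructor
  · rintro ⟨e, ⟨h1, h2, h3⟩, rfl⟩
    refine ⟨⟨bidegree_eq_iff.mpr ⟨?_, ?_⟩, fun v => Int.natCast_nonneg _⟩, ?_⟩ <;>
      dsimp only <;> omega
  · rintro ⟨⟨hu, h0⟩, hd⟩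
    obtain ⟨h1, h2⟩ := bidegree_eq_iff.mp hu
    obtain ⟨e, rfl⟩ : ∃ e : CoxVar 4 →₀ ℕ, (fun v => (e v : ℤ)) = u :=
      ⟨Finsupp.equivFunOnFinite.symm fun v => (u v).toNat,
        funext fun v => Int.toNat_of_nonneg (h0 v)⟩
    refine ⟨e, ⟨?_, ?_, ?_⟩, rfl⟩ <;> dsimp only at h1 h2 hd <;> omega

/-! ### The Hilbert polynomial -/

lemma sum_range_mul (x y : ℚ) (k : ℕ) :
    ∑ c ∈ Finset.range k, (x - c) * (y + c) =
      k * x * y + (x - y) * (k * (k - 1)) / 2 - k * (k - 1) * (2 * k - 1) / 6 := by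
  induction k with
  | zero => simp
  | succ k ih =>
    rw [Finset.sum_range_succ, ih]
    push_cast
    ring

lemma sum_range_sum_range (n : ℕ) (m : ℚ) :
    ∑ s ∈ Finset.range n, ∑ c ∈ Finset.range (s + 1), ((s + 1 : ℚ) - c) * ((s + 1 - m) + c) =
      n * (n + 1) * (n + 2) * (n - m) / 6 := by
  simp only [sum_range_mul]
  induction n with
  | zero => simp
  | succ n ih =>
    rw [Finset.sum_range_succ, ih]
    push_cast
    ring

/-- The polynomial `(m + 1)² (2m + 1) (2m + 3) / 3`. -/
def hilbertPoly : Polynomial ℚ :=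
  Polynomial.C (1 / 3) * (Polynomial.X + 1) ^ 2 * (2 * Polynomial.X + 1) * (2 * Polynomial.X + 3)

lemma eval_hilbertPoly (m : ℚ) :
    hilbertPoly.eval m = (m + 1) ^ 2 * (2 * m + 1) * (2 * m + 3) / 3 := by
  simp [hilbertPoly]
  ring

/-- The sum for the Hilbert function of `Q` starts at `s = d`, but the sum over `s < d` of the same
polynomial in `s` is zero. -/
theorem isHilbertPolynomial_Q : ProjSp.IsHilbertPolynomial Q hilbertPoly := by
  refine ⟨0, fun d _ => ?_⟩
  rw [hilbertFunction_Q, card_exponentsQ, (finite_and_card_exponents₀_le (by omega)).2,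
    eval_hilbertPoly, show 2 * d - d = d by omega]
  have h : ∀ s ∈ Finset.Ico d (2 * d + 1), ∀ c ∈ Finset.range (s + 1),
      (((s - c + 1) * (s + c + 1 - d) : ℕ) : ℚ) = ((s + 1 : ℚ) - c) * ((s + 1 - d) + c) := by
    intro s hs c hc
    rw [Finset.mem_Ico] at hs
    rw [Finset.mem_range] at hc
    rw [Nat.cast_mul, Nat.cast_add, Nat.cast_sub (by omega), Nat.cast_sub (by omega)]
    push_cast
    ring
  rw [Nat.cast_sum, Finset.sum_congr rfl fun s hs =>
    (Nat.cast_sum _ _).trans (Finset.sum_congr rfl (h s hs)),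
    Finset.sum_Ico_eq_sub _ (by omega), sum_range_sum_range, sum_range_sum_range]
  push_cast
  ring

/-- In `h⁰ - h¹`, the truncated subtractions in the two counts combine to a polynomial. -/
theorem isHilbertPolynomial_scroll :
    Scrolls.IsHilbertPolynomial ℂ twists halfAnticanonical hilbertPoly := by
  intro m
  have hD : 0 ≤ (m • halfAnticanonical).2 := by simp [halfAnticanonical]
  have h0 : {u ∈ exponents₀ twists (m • halfAnticanonical) | u (.inr 0) ≤ (2 * m : ℕ)} =
      exponents₀ twists (m • halfAnticanonical) := by
    refine Set.sep_eq_self_iff_mem_true.mpr fun u hu => ?_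
    have h1 := (bidegree_eq_iff.mp hu.1).2
    have h2 := hu.2
    have h3 := h2 (.inr 1)
    have h4 := h2 (.inr 2)
    have h5 := h2 (.inr 3)
    omega
  obtain ⟨hf0, hc0⟩ := finite_and_card_exponents₀_le (m := m) le_rfl
  obtain ⟨hf1, hc1⟩ := finite_and_card_exponents₁ m
  rw [h0] at hf0 hc0
  refine ⟨_, hasEulerChar (by norm_num) hD, ?_⟩
  rw [hc0, hc1, Nat.sub_self, ← Finset.range_eq_Ico, eval_hilbertPoly]
  have h : ∀ s : ℕ, ∀ c ∈ Finset.range (s + 1),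
      (((s - c + 1) * (s + c + 1 - m) : ℕ) : ℚ) - ((s - c + 1) * (m - 1 - (s + c)) : ℕ) =
        ((s + 1 : ℚ) - c) * ((s + 1 - m) + c) := by
    intro s c hc
    rw [Finset.mem_range] at hc
    rw [Nat.cast_mul, Nat.cast_mul, Nat.cast_add, Nat.cast_sub (by omega : c ≤ s)]
    rcases le_total m (s + c + 1) with hm | hm
    · rw [show m - 1 - (s + c) = 0 by omega, Nat.cast_sub hm]
      push_cast
      ring
    · rw [show s + c + 1 - m = 0 by omega, Nat.sub_sub, Nat.cast_sub (by omega)]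
      push_cast
      ring
  rw [Int.cast_sub, Int.cast_natCast, Int.cast_natCast, Nat.cast_sum, Nat.cast_sum,
    ← Finset.sum_sub_distrib, Finset.sum_congr rfl fun s _ => by
      rw [Nat.cast_sum, Nat.cast_sum, ← Finset.sum_sub_distrib, Finset.sum_congr rfl (h s)],
    sum_range_sum_range]
  push_cast
  ring

end HalfAnti

end

theorem proposition3p4 :
    -- the closure of the image, with its reduced structure, is cut out by the minors
    ProjSp.IsCutOutBy (Scheme.IdealSheafData.vanishingIdeal HalfAnti.Q)
      (HalfAnti.minors2 HalfAnti.M0) ∧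
    -- the linear subspace `D` is a three-dimensional projective space, and a divisor in `Q`
    (ProjSp.IsCutOutBy (Scheme.IdealSheafData.vanishingIdeal HalfAnti.D) HalfAnti.otherVariables ∧
      IsClosedImmersion (ProjSp.linearEmbedding HalfAnti.firstColumn) ∧
      (ProjSp.linearEmbedding HalfAnti.firstColumn).ker =
        Scheme.IdealSheafData.vanishingIdeal HalfAnti.D ∧
      ProjSp.IsPrimeDivisor HalfAnti.D HalfAnti.Q) ∧
    -- the Hilbert polynomials exist and agree
    (∃ P : Polynomial ℚ, ProjSp.IsHilbertPolynomial HalfAnti.Q P ∧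
      Scrolls.IsHilbertPolynomial ℂ HalfAnti.twists HalfAnti.halfAnticanonical P) := by
  exact ⟨HalfAnti.isCutOutBy_minors,
    ⟨HalfAnti.isCutOutBy_otherVariables, ProjSp.isClosedImmersion_linearEmbedding _,
      HalfAnti.ker_linearEmbedding_firstColumn, HalfAnti.isPrimeDivisor_D⟩,
    HalfAnti.hilbertPoly, HalfAnti.isHilbertPolynomial_Q, HalfAnti.isHilbertPolynomial_scroll⟩
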